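/- Theorem A. Let $X$ be a finite abstract simplicial complex, $f\colon X\to\mathbb R$ a discrete Morse function (for every $k$-simplex $x$ there is at most one $(k+1)$-simplex $y\supset x$ with $f(x)\ge f(y)$ and at most one $(k-1)$-simplex $y\subset x$ with $f(y)\ge f(x)$), and let $w,z$ be critical simplices (for which there are no such simplices $y$ at all). Let $\mathrm{Ent}[X]$ be the category whose objects are the simplices of $X$, whose morphisms $x\to y$ are the strictly descending sequences $(x=x_0>x_1>\dots>x_k=y)$ composed by concatenation, with $g\Rightarrow g'$ when $g$ is a subsequence of $g'$. Let $\Sigma$ be the set of morphisms $(y>x)$ with $x$ a codimension-one face of $y$ and $f(x)\ge f(y)$, and let $\Sigma^+$ be $\Sigma$ together with all identities. The morphisms $w\to z$ of the discrete flow category are the equivalence classes of zigzags $w\xrightarrow{g_0}y_0\xleftarrow{f_0}x_1\xrightarrow{g_1}y_1\leftarrow\cdots\xleftarrow{f_{k-1}}x_k\xrightarrow{g_k}z$ in $\mathrm{Ent}[X]$ with all $f_i\in\Sigma^+$, under the equivalence relation generated by (H) removing an intermediate identity, and (V) relating the top row and the bottom row (marked by primes) of a commutative ladder with vertical maps $u_i\colon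 y_i\to y_i'$ and $v_i\colon x_i\to x_i'$ in $\Sigma^+$ and identities at both ends. Put $\gamma'\Rightarrow\gamma$ if some representatives of $\gamma$ and $\gamma'$ are the top and bottom row of a (not necessarily commutative) ladder of this kind in which, in each square, the composite through the bottom row is $\Rightarrow$ the composite through the top row. Then $\Rightarrow$ is a partial order on the set $\mathrm{Hom}(w,z)$ of these classes, and, for the opposite poset $\mathrm{Hom}(w,z)^{\mathrm{op}}$: (1) If $\mathrm{Hom}(w,z)\neq\emptyset$, then $P_{w,z}=\mathrm{Hom}(w,z)^{\mathrm{op}}\cup\{\hat 0\}$, with $\hat 0$ adjoined as a least element, is a CW poset: it has a least element and more than one element, and for every $x\neq\hat 0$ the realization of the open interval $(\hat 0,x)$ is homeomorphic to a sphere $S^{k}$ for some $k\ge -1$ (depending on $x$), where $S^{-1}=\emptyset$. (2) $\mathrm{Hom}(w,z)^{\mathrm{op}}$ is isomorphic to the face poset (the cells ordered by inclusion of closed cells) of a regular CW complex. -/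

import Mathlib

open CategoryTheory

universe u v

/-! ### p-categories -/

/-- A p-category: a category enriched in posets. The partial order on morphisms is the relation
written `f ⇒ f'` in the literature. -/
class PCategory (C : Type u) extends Category.{v} C where
  /-- The partial order on each set of morphisms. -/
  homOrder (a b : C) : PartialOrder (a ⟶ b)
  /-- Composition is compatible with the partial orders. -/
  comp_mono {a b c : C} (f f' : a ⟶ b) (g g' : b ⟶ c) :
    (homOrder a b).le f f' → (homOrder b c).le g g' → (homOrder a c).le (f ≫ g) (f' ≫ g')

instance PCategory.instPartialOrderHom {C : Type u} [PCategory.{u, v} C] (a b : C) :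
    PartialOrder (a ⟶ b) :=
  PCategory.homOrder a b

/-! ### The entrance path category -/

/-- The objects of the entrance path category of a complex whose poset of cells is `P`. -/
@[ext]
structure Ent (P : Type u) where
  /-- The underlying cell. -/
  cell : P

/-- A strictly descending sequence of cells `x = x₀ > x₁ > ⋯ > x_k = y`. -/
@[ext]
structure EntHom {P : Type u} [PartialOrder P] (x y : P) where
  /-- The sequence. -/
  seq : List P
  /-- Consecutive terms are strictly descending. -/
  descending : seq.IsChain (· > ·)
  /-- The sequence starts with `x`. -/
  head_eq : seq.head? = some x
  /-- The sequence ends with `y`. -/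
  last_eq : seq.getLast? = some y

namespace EntHom

variable {P : Type u} [PartialOrder P]

/-- The sequence with a single element. -/
def id (x : P) : EntHom x x where
  seq := [x]
  descending := by simp
  head_eq := rfl
  last_eq := rfl

/-- The sequence `x > y`. -/
def pair {x y : P} (h : y < x) : EntHom x y where
  seq := [x, y]
  descending := by simpa using h
  head_eq := rfl
  last_eq := rfl

theorem seq_eq_cons {x y : P} (f : EntHom x y) : f.seq = x :: f.seq.tail := by
  obtain ⟨l, h1, h2, h3⟩ := f
  cases l with
  | nil => simp at h2
  | cons a l => simp at h2; simp [h2]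

/-- Concatenation of `x > ⋯ > y` and `y > ⋯ > z`, the common term `y` being written once. -/
def comp {x y z : P} (f : EntHom x y) (g : EntHom y z) : EntHom x z where
  seq := f.seq ++ g.seq.tail
  descending := by
    have hg := g.descending
    rw [seq_eq_cons g] at hg
    rw [List.isChain_append]
    refine ⟨f.descending, g.descending.tail, ?_⟩
    intro a ha b hb
    rw [f.last_eq] at ha
    obtain rfl : y = a := by simpa using ha
    generalize g.seq.tail = t at hg hb
    cases t with
    | nil => simp at hb
    | cons c t =>
      obtain rfl : c = b := by simpa using hb
      exact (List.isChain_cons_cons.1 hg).1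
  head_eq := by rw [seq_eq_cons f]; rfl
  last_eq := by
    have hg := g.last_eq
    rw [seq_eq_cons g] at hg
    rw [List.getLast?_append, f.last_eq]
    generalize g.seq.tail = t at hg
    cases t with
    | nil => simpa using hg
    | cons c t =>
      rw [List.getLast?_cons_cons] at hg
      simp [hg]

end EntHom

/-- The entrance path category: morphisms are strictly descending sequences of cells, composed by
concatenation, and `f ⇒ f'` when `f` is a (not necessarily contiguous) subsequence of `f'`. -/
instance Ent.instPCategory (P : Type u) [PartialOrder P] : PCategory.{u, u} (Ent P) where
  Hom a b := EntHom a.cell b.cell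
  id a := EntHom.id a.cell
  comp f g := f.comp g
  id_comp f := by
    ext1
    simp [EntHom.comp, EntHom.id, ← EntHom.seq_eq_cons]
  comp_id f := by
    ext1
    simp [EntHom.comp, EntHom.id]
  assoc f g h := by
    ext1
    simp only [EntHom.comp]
    rw [EntHom.seq_eq_cons g]
    simp
  homOrder a b :=
    { le := fun f f' => f.seq.Sublist f'.seq
      le_refl := fun _ => List.Sublist.refl _
      le_trans := fun _ _ _ => List.Sublist.trans
      le_antisymm := fun _ _ h h' => EntHom.ext (h.antisymm h') }
  comp_mono f f' g g' hf hg := List.Sublist.append hf hg.tail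

/-! ### Localization of a p-category -/

/-- The collection `Σ⁺`: the union of `S` with all identities. -/
inductive PlusId {C : Type u} [PCategory.{u, v} C] (S : MorphismProperty C) :
    ∀ {a b : C}, (a ⟶ b) → Prop
  | of {a b : C} (f : a ⟶ b) (hf : S f) : PlusId S f
  | id (a : C) : PlusId S (𝟙 a)

/-- Zigzags `w → y₀ ← x₁ → y₁ ← ⋯ ← x_k → z` whose left-pointing arrows are in `Σ⁺`. -/
inductive LocZigzag {C : Type u} [PCategory.{u, v} C] (S : MorphismProperty C) :
    C → C → Type (max u v)
  | arrow {w z : C} (g : w ⟶ z) : LocZigzag S w z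
  | cons {w y x z : C} (g : w ⟶ y) (f : x ⟶ y) (hf : PlusId S f) (r : LocZigzag S x z) : LocZigzag S w z

namespace LocZigzag

variable {C : Type u} [PCategory.{u, v} C] {S : MorphismProperty C}

/-- Precomposition of the first arrow of a zigzag. -/
def precomp {a w : C} (h : a ⟶ w) : ∀ {z : C}, LocZigzag S w z → LocZigzag S a z
  | _, arrow g => arrow (h ≫ g)
  | _, cons g f hf r => cons (h ≫ g) f hf r

/-- Concatenation of zigzags, composing the two arrows that meet. -/
def append : ∀ {a b c : C}, LocZigzag S a b → LocZigzag S b c → LocZigzag S a c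
  | _, _, _, arrow g, s => precomp g s
  | _, _, _, cons g f hf r, s => cons g f hf (append r s)

/-- The horizontal relation: removal of an intermediate left-pointing identity,
`x → y ← y → y'` (the left-pointing arrow being `𝟙 y`) is replaced by the composite `x → y'`. -/
inductive Horizontal : ∀ {w z : C}, LocZigzag S w z → LocZigzag S w z → Prop
  | remove {w y z : C} (g : w ⟶ y) (r : LocZigzag S y z) :
      Horizontal (cons g (𝟙 y) (PlusId.id y) r) (precomp g r)
  | cons {w y x z : C} (g : w ⟶ y) (f : x ⟶ y) (hf : PlusId S f) {r r' : LocZigzag S x z}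
      (h : Horizontal r r') : Horizontal (cons g f hf r) (cons g f hf r')

/-- `VerticalFrom v τ τ'`: the zigzags `τ` and `τ'` are the top and bottom row of a commutative
ladder whose first vertical arrow is `v`, whose last vertical arrow is an identity and whose other
vertical arrows are in `Σ⁺`. -/
inductive VerticalFrom : ∀ {w w' z : C}, (w ⟶ w') → LocZigzag S w z → LocZigzag S w' z → Prop
  | arrow {w w' z : C} (v : w ⟶ w') (g : w ⟶ z) (g' : w' ⟶ z) (hg : g = v ≫ g') :
      VerticalFrom v (arrow g) (arrow g')
  | cons {w w' y y' x x' z : C} (v : w ⟶ w') (u : y ⟶ y') (v₁ : x ⟶ x')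
      (hu : PlusId S u) (hv₁ : PlusId S v₁)
      (g : w ⟶ y) (f : x ⟶ y) (hf : PlusId S f) (r : LocZigzag S x z)
      (g' : w' ⟶ y') (f' : x' ⟶ y') (hf' : PlusId S f') (r' : LocZigzag S x' z)
      (hg : g ≫ u = v ≫ g') (hfu : f ≫ u = v₁ ≫ f') (hr : VerticalFrom v₁ r r') :
      VerticalFrom v (cons g f hf r) (cons g' f' hf' r')

/-- The generating relation on zigzags from `w` to `z`: horizontally or vertically related. -/
def Step {w z : C} (τ τ' : LocZigzag S w z) : Prop :=
  Horizontal τ τ' ∨ VerticalFrom (𝟙 w) τ τ'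

/-- Zigzags up to the equivalence relation generated by the horizontal and vertical relations. -/
def setoid (S : MorphismProperty C) (w z : C) : Setoid (LocZigzag S w z) :=
  Relation.EqvGen.setoid Step

/-- `LadderFrom v τ τ'`: the zigzags `τ` and `τ'` are the top and bottom row of a (not necessarily
commutative) ladder whose first vertical arrow is `v`, whose last vertical arrow is an identity and
whose other vertical arrows are in `Σ⁺`, such that in every square the composite through the
bottom row is below (`⇒`) the composite through the top row. -/
inductive LadderFrom : ∀ {w w' z : C}, (w ⟶ w') → LocZigzag S w z → LocZigzag S w' z → Prop
  | arrow {w w' z : C} (v : w ⟶ w') (g : w ⟶ z) (g' : w' ⟶ z) (hg : v ≫ g' ≤ g) :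
      LadderFrom v (arrow g) (arrow g')
  | cons {w w' y y' x x' z : C} (v : w ⟶ w') (u : y ⟶ y') (v₁ : x ⟶ x')
      (hu : PlusId S u) (hv₁ : PlusId S v₁)
      (g : w ⟶ y) (f : x ⟶ y) (hf : PlusId S f) (r : LocZigzag S x z)
      (g' : w' ⟶ y') (f' : x' ⟶ y') (hf' : PlusId S f') (r' : LocZigzag S x' z)
      (hg : v ≫ g' ≤ g ≫ u) (hfu : v₁ ≫ f' ≤ f ≫ u) (hr : LadderFrom v₁ r r') :
      LadderFrom v (cons g f hf r) (cons g' f' hf' r')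

theorem precomp_precomp {a b c d : C} (h : a ⟶ b) (k : b ⟶ c) (r : LocZigzag S c d) :
    precomp h (precomp k r) = precomp (h ≫ k) r := by
  cases r <;> simp [precomp]

theorem id_precomp {a b : C} (r : LocZigzag S a b) : precomp (𝟙 a) r = r := by
  cases r <;> simp [precomp]

theorem append_precomp {a b c d : C} (h : a ⟶ b) (r : LocZigzag S b c) (s : LocZigzag S c d) :
    append (precomp h r) s = precomp h (append r s) := by
  cases r with
  | arrow g => exact (precomp_precomp h g s).symm
  | cons g f hf r => rfl

theorem append_assoc {a b c d : C} (r : LocZigzag S a b) (s : LocZigzag S b c) (t : LocZigzag S c d) :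
    append (append r s) t = append r (append s t) := by
  induction r with
  | arrow g => simp [append, append_precomp]
  | cons g f hf r ih => simp [append, ih]

theorem append_id {a b : C} (r : LocZigzag S a b) : append r (arrow (𝟙 b)) = r := by
  induction r with
  | arrow g => simp [append, precomp]
  | cons g f hf r ih => simp [append, ih]

theorem VerticalFrom.refl {a b : C} (r : LocZigzag S a b) : VerticalFrom (𝟙 a) r r := by
  induction r with
  | arrow g => exact .arrow _ _ _ (by simp)
  | cons g f hf r ih =>
    exact .cons _ (𝟙 _) (𝟙 _) (.id _) (.id _) _ _ _ _ _ _ _ _ (by simp) (by simp) ih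

theorem VerticalFrom.precomp {a b b' c : C} {v : b ⟶ b'} {h : a ⟶ b} {h' : a ⟶ b'}
    (hh : h' = h ≫ v) {r : LocZigzag S b c} {r' : LocZigzag S b' c} (H : VerticalFrom v r r') :
    VerticalFrom (𝟙 a) (r.precomp h) (r'.precomp h') := by
  subst hh
  cases H with
  | arrow v g g' hg => exact .arrow _ _ _ (by simp [hg])
  | cons v u v₁ hu hv₁ g f hf r g' f' hf' r' hg hfu hr =>
    exact .cons _ u v₁ hu hv₁ _ _ _ _ _ _ _ _ (by simp [hg]) hfu hr

theorem VerticalFrom.precomp' {a a' b c : C} {v : a ⟶ a'} {h : a ⟶ b} {h' : a' ⟶ b}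
    (hh : h = v ≫ h') (r : LocZigzag S b c) :
    VerticalFrom v (r.precomp h) (r.precomp h') := by
  subst hh
  cases r with
  | arrow g => exact .arrow _ _ _ (by simp)
  | cons g f hf r =>
    exact .cons _ (𝟙 _) (𝟙 _) (.id _) (.id _) _ _ _ _ _ _ _ _ (by simp) (by simp) (.refl r)

theorem VerticalFrom.append_right {a a' b c : C} {v : a ⟶ a'} {r : LocZigzag S a b}
    {r' : LocZigzag S a' b} (H : VerticalFrom v r r') (s : LocZigzag S b c) :
    VerticalFrom v (r.append s) (r'.append s) := by
  induction H with
  | arrow v g g' hg => exact .precomp' hg s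
  | cons v u v₁ hu hv₁ g f hf r g' f' hf' r' hg hfu hr ih =>
    exact .cons v u v₁ hu hv₁ _ _ _ _ _ _ _ _ hg hfu (ih s)

theorem VerticalFrom.append_left {a b c : C} (r : LocZigzag S a b) {s s' : LocZigzag S b c}
    (H : VerticalFrom (𝟙 b) s s') : VerticalFrom (𝟙 a) (r.append s) (r.append s') := by
  induction r with
  | arrow g => exact H.precomp (by simp)
  | cons g f hf r ih =>
    exact .cons _ (𝟙 _) (𝟙 _) (.id _) (.id _) _ _ _ _ _ _ _ _ (by simp) (by simp) (ih H)

theorem Horizontal.precomp {a b c : C} (h : a ⟶ b) {r r' : LocZigzag S b c} (H : Horizontal r r') :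
    Horizontal (r.precomp h) (r'.precomp h) := by
  cases H with
  | remove g r =>
    rw [precomp_precomp]
    exact .remove _ _
  | cons g f hf H => exact .cons _ _ _ H

theorem Horizontal.append_right {a b c : C} {r r' : LocZigzag S a b} (H : Horizontal r r')
    (s : LocZigzag S b c) : Horizontal (r.append s) (r'.append s) := by
  induction H with
  | remove g r =>
    rw [append_precomp]
    exact .remove _ _
  | cons g f hf H ih => exact .cons _ _ _ (ih s)

theorem Horizontal.append_left {a b c : C} (r : LocZigzag S a b) {s s' : LocZigzag S b c}
    (H : Horizontal s s') : Horizontal (r.append s) (r.append s') := by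
  induction r with
  | arrow g => exact H.precomp g
  | cons g f hf r ih => exact .cons _ _ _ (ih H)

theorem append_congr {a b c : C} {r r' : LocZigzag S a b} {s s' : LocZigzag S b c}
    (hr : Relation.EqvGen Step r r') (hs : Relation.EqvGen Step s s') :
    Relation.EqvGen Step (r.append s) (r'.append s') := by
  have h₁ : Relation.EqvGen Step (r.append s) (r'.append s) := by
    clear hs
    induction hr with
    | rel _ _ h => exact .rel _ _ (h.imp (·.append_right s) (·.append_right s))
    | refl _ => exact .refl _
    | symm _ _ _ ih => exact .symm _ _ ih
    | trans _ _ _ _ _ ih ih' => exact .trans _ _ _ ih ih'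
  have h₂ : Relation.EqvGen Step (r'.append s) (r'.append s') := by
    clear h₁ hr
    induction hs with
    | rel _ _ h => exact .rel _ _ (h.imp (·.append_left r') (·.append_left r'))
    | refl _ => exact .refl _
    | symm _ _ _ ih => exact .symm _ _ ih
    | trans _ _ _ _ _ ih ih' => exact .trans _ _ _ ih ih'
  exact .trans _ _ _ h₁ h₂

end LocZigzag

/-- Morphisms of the localization of a p-category at `S`: equivalence classes of zigzags. -/
def LocHom {C : Type u} [PCategory.{u, v} C] (S : MorphismProperty C) (w z : C) :
    Type (max u v) :=
  Quotient (LocZigzag.setoid S w z)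

namespace LocHom

variable {C : Type u} [PCategory.{u, v} C] {S : MorphismProperty C}

/-- The class of a zigzag. -/
def mk {w z : C} (τ : LocZigzag S w z) : LocHom S w z :=
  Quotient.mk (LocZigzag.setoid S w z) τ

/-- Composition, by concatenating representatives. -/
def comp {a b c : C} : LocHom S a b → LocHom S b c → LocHom S a c :=
  Quotient.map₂ LocZigzag.append fun _ _ hr _ _ hs => LocZigzag.append_congr hr hs

/-- The relation `γ' ⇒ γ`: some representatives of `γ` and `γ'` are the top and bottom row of
a ladder with all squares oriented from the bottom to the top. -/
def Implies {w z : C} (γ' γ : LocHom S w z) : Prop :=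
  ∃ τ τ' : LocZigzag S w z, mk τ = γ ∧ mk τ' = γ' ∧ LocZigzag.LadderFrom (𝟙 w) τ τ'

end LocHom

/-- The objects of the localization of a p-category at `S`. -/
structure Loc {C : Type u} [PCategory.{u, v} C] (S : MorphismProperty C) where
  /-- The underlying object. -/
  obj : C

instance Loc.instCategory {C : Type u} [PCategory.{u, v} C] (S : MorphismProperty C) :
    Category.{max u v} (Loc S) where
  Hom w z := LocHom S w.obj z.obj
  id w := LocHom.mk (LocZigzag.arrow (𝟙 w.obj))
  comp γ δ := LocHom.comp γ δ
  id_comp γ := by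
    induction γ using Quotient.inductionOn with
    | h τ => exact congrArg LocHom.mk (LocZigzag.id_precomp τ)
  comp_id γ := by
    induction γ using Quotient.inductionOn with
    | h τ => exact congrArg LocHom.mk (LocZigzag.append_id τ)
  assoc γ δ ε := by
    induction γ using Quotient.inductionOn with
    | h τ =>
      induction δ using Quotient.inductionOn with
      | h τ' =>
        induction ε using Quotient.inductionOn with
        | h τ'' => exact congrArg LocHom.mk (LocZigzag.append_assoc τ τ' τ'')

/-! ### Discrete Morse functions on simplicial complexes -/

/-- The cells (nonempty simplices) of a simplicial complex, ordered by inclusion. -/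
abbrev Cell {V : Type u} (X : PreAbstractSimplicialComplex V) : Type u :=
  {s : Finset V // s ∈ X.faces}

/-- `x` is a face of `y` of codimension one. -/
def IsFacet {V : Type u} {X : PreAbstractSimplicialComplex V} (x y : Cell X) : Prop :=
  x ≤ y ∧ y.1.card = x.1.card + 1

/-- A discrete Morse function on a simplicial complex. -/
structure DiscreteMorseFunction {V : Type u} (X : PreAbstractSimplicialComplex V) where
  /-- The value on each cell. -/
  toFun : Cell X → ℝ
  /-- There is at most one `(k+1)`-cell `y` containing the `k`-cell `x` with `f x ≥ f y`. -/
  coface (x y y' : Cell X) : IsFacet x y → toFun x ≥ toFun y →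
    IsFacet x y' → toFun x ≥ toFun y' → y = y'
  /-- There is at most one `(k-1)`-cell `y` contained in the `k`-cell `x` with `f y ≥ f x`. -/
  face (x y y' : Cell X) : IsFacet y x → toFun y ≥ toFun x →
    IsFacet y' x → toFun y' ≥ toFun x → y = y'

namespace DiscreteMorseFunction

variable {V : Type u} {X : PreAbstractSimplicialComplex V}

/-- A cell is critical if it has no exceptional coface and no exceptional face. -/
def IsCritical (f : DiscreteMorseFunction X) (x : Cell X) : Prop :=
  (¬ ∃ y, IsFacet x y ∧ f.toFun x ≥ f.toFun y) ∧ (¬ ∃ y, IsFacet y x ∧ f.toFun y ≥ f.toFun x)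

/-- `{x, y}` is a regular pair: `x` is a face of codimension one of `y` and `f x ≥ f y`. -/
def IsRegularPair (f : DiscreteMorseFunction X) (x y : Cell X) : Prop :=
  IsFacet x y ∧ f.toFun x ≥ f.toFun y

/-- The Morse system of `f`: the morphisms `(y > x)` of the entrance path category, for the regular
pairs `{x, y}` with `x` a face of `y`. -/
def morseSystem (f : DiscreteMorseFunction X) : MorphismProperty (Ent (Cell X)) :=
  fun y x g => f.IsRegularPair x.cell y.cell ∧ ∃ h : x.cell < y.cell, g = EntHom.pair h

/-- The objects of the discrete flow category: the critical cells. -/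
structure Flo (f : DiscreteMorseFunction X) where
  /-- The underlying cell. -/
  cell : Cell X
  /-- The cell is critical. -/
  critical : f.IsCritical cell

/-- A critical cell as an object of the localization of the entrance path category. -/
def Flo.toLoc {f : DiscreteMorseFunction X} (w : Flo f) : Loc f.morseSystem :=
  ⟨⟨w.cell⟩⟩

/-- The discrete flow category: the full subcategory, on the critical cells, of the localization of
the entrance path category at the Morse system. -/
instance Flo.instCategory (f : DiscreteMorseFunction X) : Category.{u} (Flo f) where
  Hom w z := w.toLoc ⟶ z.toLoc
  id w := 𝟙 w.toLoc
  comp γ δ := CategoryStruct.comp (obj := Loc f.morseSystem) γ δ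
  id_comp γ := Category.id_comp (obj := Loc f.morseSystem) γ
  comp_id γ := Category.comp_id (obj := Loc f.morseSystem) γ
  assoc γ δ ε := Category.assoc (obj := Loc f.morseSystem) γ δ ε

/-- The relation `γ ⇒ γ'` on the morphisms of the discrete flow category. -/
def Flo.Implies {f : DiscreteMorseFunction X} {w z : Flo f} (γ γ' : w ⟶ z) : Prop :=
  LocHom.Implies (S := f.morseSystem) (w := ⟨w.cell⟩) (z := ⟨z.cell⟩) γ γ'

end DiscreteMorseFunction

/-! ### Realization of posets and CW posets -/

/-- The realization of a poset, i.e. the geometric realization of the simplicial complex of its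
finite nonempty chains: families of nonnegative weights with sum one, supported on a finite
chain. -/
structure PosetRealization (P : Type u) [PartialOrder P] where
  /-- The barycentric coordinates. -/
  weight : P → ℝ
  /-- The coordinates are nonnegative. -/
  nonneg : ∀ p, 0 ≤ weight p
  /-- The coordinates are supported on a finite chain and have sum one. -/
  chain : ∃ c : Finset P, IsChain (· ≤ ·) (c : Set P) ∧ (∀ p ∉ c, weight p = 0) ∧
    ∑ p ∈ c, weight p = 1

/-- The points of the realization that lie in the finite subcomplex spanned by `s`. -/
def PosetRealization.Sub {P : Type u} [PartialOrder P] (s : Finset P) : Type u :=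
  {t : PosetRealization P // ∀ p ∉ s, t.weight p = 0}

/-- A finite subcomplex has the Euclidean topology, given by the coordinates. -/
instance PosetRealization.instTopologicalSpaceSub {P : Type u} [PartialOrder P] (s : Finset P) :
    TopologicalSpace (PosetRealization.Sub s) :=
  TopologicalSpace.induced (fun t => t.1.weight) inferInstance

/-- The weak topology: a set is open when its trace on every finite subcomplex is. -/
instance PosetRealization.instTopologicalSpace {P : Type u} [PartialOrder P] :
    TopologicalSpace (PosetRealization P) :=
  ⨆ s : Finset P, TopologicalSpace.coinduced (fun t : PosetRealization.Sub s => t.1) inferInstance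

/-- A space is a sphere if it is homeomorphic to the unit sphere `S^(n-1)` of some Euclidean space
`ℝⁿ`, `n ≥ 0`; for `n = 0` this is the empty sphere `S^(-1)`. -/
def IsSphere (Y : Type u) [TopologicalSpace Y] : Prop :=
  ∃ n : ℕ, Nonempty (Y ≃ₜ Metric.sphere (0 : EuclideanSpace ℝ (Fin n)) 1)

/-- A CW poset: a poset with a least element and more than one element, in which every open interval
from the least element to another element realizes to a sphere. -/
def IsCWPoset (P : Type u) [PartialOrder P] : Prop :=
  ∃ o : P, IsLeast Set.univ o ∧ Nontrivial P ∧
    ∀ x : P, x ≠ o → IsSphere (PosetRealization (Set.Ioo o x))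

/-- A poset is the face poset of a regular CW complex: there are a Hausdorff space `Y` and a CW
structure on `Y` with characteristic maps that are injective on the closed balls (hence
homeomorphisms onto the closed cells), such that the poset is isomorphic to the set of cells ordered
by inclusion of closed cells. -/
def IsRegularCWFacePoset (P : Type u) [PartialOrder P] : Prop :=
  ∃ (Y : Type u) (_ : TopologicalSpace Y) (_ : T2Space Y)
    (_ : Topology.CWComplex (Set.univ : Set Y)),
    (∀ (n : ℕ) (e : Topology.RelCWComplex.cell (Set.univ : Set Y) n),
      Set.InjOn (Topology.RelCWComplex.map n e) (Metric.closedBall 0 1)) ∧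
    ∃ φ : P ≃ (Σ n : ℕ, Topology.RelCWComplex.cell (Set.univ : Set Y) n),
      ∀ a b : P, a ≤ b ↔
        Topology.RelCWComplex.closedCell (C := (Set.univ : Set Y)) (φ a).1 (φ a).2 ⊆
          Topology.RelCWComplex.closedCell (C := (Set.univ : Set Y)) (φ b).1 (φ b).2

/-!
# The order on the morphisms of the discrete flow category

The entrance path category is the free category on the edges `x > y` between cells, so its
localization at the Morse system is a category of paths in which the matched edges `x > u` may also
be traversed backwards. Hence a morphism of the localization is given by a path word in the letters
`((x, y), true)` (a step down) and `((x, u), false)` (a matched edge, going up), up to cancellation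
of mutually inverse letters (`Eval.exists_isReduced`, `Eval.homGroup_eq`): morphisms from `x` to `z`
embed into the free group on the pairs of cells.

In this description `γ ⇒ γ'` means that the word of `γ'` arises from that of `γ` by refining each
step down to a strictly descending sequence (`below_iff_implies`). As matched edges have codimension
one and cannot be refined, the choice of the word of `γ` does not matter. A refinement of a reduced
word may fail to be reduced, but nevertheless it is determined by the morphism it represents: a step
down `(x > y)` in a reduced path word is followed only by letters whose upper cells have smaller
rank than `x` (the rank being the dimension first, then the value of the discrete Morse function;
`Eval.rank_bounds`), so that the first letter at which two refinements differ occurs in only one of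
them (`Eval.eq_of_mk_seqWord_append`). Therefore `⇒` is a partial order, and the morphisms above `γ`
form the product, over the letters `(x > y)` of its reduced word, of the posets of strictly
descending sequences from `x` to `y` (`Eval.exists_parametrization`).

The sequences from `x` to `y` form the opposite of the face poset of a permutohedron: they are the
cones of the braid fan, since a function on the vertices of `x` outside `y` has a chain of
superlevel sets. Consequently the elements strictly above `γ` carry the barycentric subdivision of a
complete fan (`isChainFan_pathVector`), of dimension the sum of `|x| - |y| - 1` over the letters. A
poset with such a fan realizes to a sphere, and its cone to a ball
(`IsChainFan.nonempty_homeomorph_sphere`, `IsChainFan.exists_homeomorph_closedBall`); so the cones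
in the realization of the whole opposite poset are the closed cells of a regular CW structure
(`isRegularCWFacePoset_of_isChainFan`).
-/

/-! ### Entrance paths -/

namespace EntHom

variable {P : Type u} [PartialOrder P]

/-- Entrance paths are built from trivial ones by prepending a single descent. -/
theorem pair_comp_induction {C : ∀ {x y : P}, EntHom x y → Prop} (id : ∀ x, C (EntHom.id x))
    (cons : ∀ {x y z : P} (h : y < x) (g : EntHom y z), C g → C ((pair h).comp g)) :
    ∀ {x y : P} (g : EntHom x y), C g := by
  suffices H : ∀ (l : List P) (x y : P) (g : EntHom x y), g.seq = l → C g from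
    fun {_ _} g => H _ _ _ g rfl
  intro l
  induction l with
  | nil => intro x y g hg; have := g.seq_eq_cons; simp [hg] at this
  | cons a l ih =>
    intro x y g hg
    obtain rfl : x = a := by have := g.head_eq; simpa [hg] using this.symm
    cases l with
    | nil =>
      obtain rfl : x = y := by have := g.last_eq; simpa [hg] using this
      obtain rfl : g = EntHom.id x := EntHom.ext hg
      exact id x
    | cons b l =>
      have hd := g.descending
      rw [hg, List.isChain_cons_cons] at hd
      let g' : EntHom b y := ⟨b :: l, hd.2, rfl, by have := g.last_eq; simpa [hg] using this⟩
      have hgg : g = (pair hd.1).comp g' := EntHom.ext hg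
      rw [hgg]
      exact cons hd.1 g' (ih _ _ _ rfl)

theorem comp_assoc {x y z w : P} (f : EntHom x y) (g : EntHom y z) (h : EntHom z w) :
    (f.comp g).comp h = f.comp (g.comp h) :=
  Category.assoc (obj := Ent P) (W := ⟨x⟩) (X := ⟨y⟩) (Y := ⟨z⟩) (Z := ⟨w⟩) f g h

theorem id_comp {x y : P} (f : EntHom x y) : (EntHom.id x).comp f = f :=
  Category.id_comp (obj := Ent P) (X := ⟨x⟩) (Y := ⟨y⟩) f

theorem comp_id {x y : P} (f : EntHom x y) : f.comp (EntHom.id y) = f :=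
  Category.comp_id (obj := Ent P) (X := ⟨x⟩) (Y := ⟨y⟩) f

theorem head_mem {x y : P} (g : EntHom x y) : x ∈ g.seq := List.mem_of_head? g.head_eq

theorem last_mem {x y : P} (g : EntHom x y) : y ∈ g.seq := List.mem_of_getLast? g.last_eq

theorem mem_Icc {x y : P} (g : EntHom x y) : ∀ c ∈ g.seq, y ≤ c ∧ c ≤ x := by
  induction g using pair_comp_induction with
  | id x => simp [EntHom.id]
  | @cons x y z h g ih =>
    intro c hc
    have hc' : c = x ∨ c ∈ g.seq := by
      have h2 := g.seq_eq_cons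
      simp only [comp, pair, List.cons_append, List.nil_append] at hc
      rw [← h2] at hc
      simpa using hc
    rcases hc' with rfl | hc'
    · exact ⟨(ih y g.head_mem).1.trans h.le, le_rfl⟩
    · exact ⟨(ih c hc').1, (ih c hc').2.trans h.le⟩

theorem le {x y : P} (g : EntHom x y) : y ≤ x := (g.mem_Icc x g.head_mem).1

theorem pair_comp_seq {x y z : P} (h : y < x) (g : EntHom y z) :
    ((pair h).comp g).seq = x :: g.seq := by
  have := g.seq_eq_cons
  simp only [comp, pair, List.cons_append, List.nil_append]
  rw [← this]

theorem eq_id {x : P} (g : EntHom x x) : g = EntHom.id x := by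
  suffices H : ∀ {x y : P} (g : EntHom x y), x = y → g.seq = [x] from EntHom.ext (H g rfl)
  intro x y g
  induction g using pair_comp_induction with
  | id x => simp [EntHom.id]
  | @cons x y z h g ih => intro hxz; subst hxz; exact absurd g.le h.not_ge

theorem exists_eq_pair_comp {x y : P} (g : EntHom x y) (h : y < x) :
    ∃ (a : P) (ha : a < x) (g' : EntHom a y), g = (pair ha).comp g' := by
  suffices H : ∀ {x y : P} (g : EntHom x y), x ≠ y →
      ∃ (a : P) (ha : a < x) (g' : EntHom a y), g = (pair ha).comp g' from H g h.ne'
  intro x y g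
  induction g using pair_comp_induction with
  | id x => simp
  | @cons x y z h g ih => intro _; exact ⟨_, h, g, rfl⟩

/-- An edge of the Hasse diagram admits no proper refinement. -/
theorem eq_pair_of_covBy {x y : P} (h : y ⋖ x) (g : EntHom x y) : g = pair h.1 := by
  obtain ⟨a, ha, g', rfl⟩ := g.exists_eq_pair_comp h.1
  obtain rfl : a = y := (h.eq_or_eq g'.le ha.le).resolve_right ha.ne
  rw [g'.eq_id, comp_id]

theorem pair_sublist {x y : P} (h : y < x) (g : EntHom x y) : (pair h).seq.Sublist g.seq := by
  obtain ⟨a, ha, g', rfl⟩ := g.exists_eq_pair_comp h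
  rw [pair_comp_seq]
  exact (List.singleton_sublist.2 g'.last_mem).cons_cons x

end EntHom

/-! ### Words in the edges of a poset -/

section Words

variable {P : Type u}

/-- The word in the free group on pairs of cells spelled by a sequence of cells. -/
def seqWord : List P → List ((P × P) × Bool)
  | a :: b :: l => ((a, b), true) :: seqWord (b :: l)
  | _ => []

theorem seqWord_append (l : List P) (a : P) (t : List P) :
    seqWord (l ++ a :: t) = seqWord (l ++ [a]) ++ seqWord (a :: t) := by
  induction l with
  | nil => simp [seqWord]
  | cons b l ih =>
    cases l with
    | nil => simp [seqWord]
    | cons c l => simpa [seqWord] using ih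

variable [PartialOrder P]

theorem seqWord_comp {x y z : P} (f : EntHom x y) (g : EntHom y z) :
    seqWord (f.comp g).seq = seqWord f.seq ++ seqWord g.seq := by
  obtain ⟨l, hl⟩ : ∃ l, f.seq = l ++ [y] := List.getLast?_eq_some_iff.1 f.last_eq
  have hg := g.seq_eq_cons
  rw [hg]
  simp only [EntHom.comp, hl]
  rw [List.append_assoc, List.singleton_append]
  exact seqWord_append _ _ _

theorem seqWord_pair {x y : P} (h : y < x) : seqWord (EntHom.pair h).seq = [((x, y), true)] := rfl

theorem seqWord_id (x : P) : seqWord (EntHom.id x).seq = [] := rfl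

theorem seqWord_pair_comp {x y z : P} (h : y < x) (g : EntHom y z) :
    seqWord ((EntHom.pair h).comp g).seq = ((x, y), true) :: seqWord g.seq := by
  rw [seqWord_comp, seqWord_pair]; rfl

end Words

/-! ### Acyclic matchings and their Morse systems -/

/-- An acyclic partial matching on a poset, acyclicity being witnessed by a rank function which
drops along alternating paths. -/
structure AcyclicMatching (P : Type u) [PartialOrder P] where
  /-- `pair x u`: the larger cell `x` is matched with the smaller cell `u`. -/
  pair : P → P → Prop
  /-- The function which drops along alternating paths. -/
  rank : P → ℕ ×ₗ ℝ
  /-- Matched pairs are edges of the Hasse diagram. -/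
  covBy {x u : P} : pair x u → u ⋖ x
  /-- A cell is matched with at most one larger cell. -/
  upper_unique {x x' u : P} : pair x u → pair x' u → x = x'
  /-- Matched edges are not composable. -/
  not_pair {x u v : P} : pair x u → ¬ pair u v
  /-- The rank drops when passing to a face. -/
  rank_strictMono : StrictMono rank
  /-- The rank drops when descending from `x` to `u` and ascending along a matched edge to `x'`. -/
  rank_lt {x x' u : P} : u < x → ¬ pair x u → pair x' u → rank x' < rank x

namespace AcyclicMatching

variable {P : Type u} [PartialOrder P] (M : AcyclicMatching P)

/-- The morphisms of the entrance path category given by the matched pairs. -/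
def morphisms : MorphismProperty (Ent P) :=
  fun x u g => M.pair x.cell u.cell ∧ ∃ h : u.cell < x.cell, g = EntHom.pair h

/-- A cell, as an object of the localization. -/
abbrev obj (x : P) : Loc M.morphisms := ⟨⟨x⟩⟩

/-- The image of an entrance path in the localization. -/
def ofEnt {x y : P} (g : EntHom x y) : M.obj x ⟶ M.obj y :=
  LocHom.mk (LocZigzag.arrow (w := (⟨x⟩ : Ent P)) (z := ⟨y⟩) g)

theorem ofEnt_comp {x y z : P} (f : EntHom x y) (g : EntHom y z) :
    M.ofEnt (f.comp g) = M.ofEnt f ≫ M.ofEnt g := rfl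

variable {M}

theorem plusId_pair {x u : P} (h : M.pair x u) :
    PlusId M.morphisms (a := (⟨x⟩ : Ent P)) (b := ⟨u⟩) (EntHom.pair (M.covBy h).1) :=
  .of _ ⟨h, _, rfl⟩

/-- The inverse of a matched edge in the localization. -/
def up {x u : P} (h : M.pair x u) : M.obj u ⟶ M.obj x :=
  LocHom.mk (LocZigzag.cons (𝟙 (⟨u⟩ : Ent P)) (EntHom.pair (M.covBy h).1) (plusId_pair h)
    (.arrow (𝟙 (⟨x⟩ : Ent P))))

theorem mk_eq_of_step {S : MorphismProperty (Ent P)} {w z : Ent P} {τ τ' : LocZigzag S w z}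
    (h : LocZigzag.Step τ τ') : LocHom.mk τ = LocHom.mk τ' :=
  Quotient.sound (Relation.EqvGen.rel _ _ h)

theorem mk_cons_id {w y z : Ent P} (g : w ⟶ y) (r : LocZigzag M.morphisms y z) :
    LocHom.mk (.cons g (𝟙 y) (.id y) r) = LocHom.mk (r.precomp g) :=
  mk_eq_of_step (.inl (.remove g r))

theorem ofEnt_up {x u : P} (h : M.pair x u) :
    M.ofEnt (EntHom.pair (M.covBy h).1) ≫ up h = 𝟙 (M.obj x) := by
  let s : (⟨x⟩ : Ent P) ⟶ ⟨u⟩ := EntHom.pair (M.covBy h).1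
  have hs : PlusId M.morphisms s := plusId_pair h
  refine Eq.trans (b := LocHom.mk (.cons (𝟙 _) (𝟙 _) (.id _) (.arrow (𝟙 (⟨x⟩ : Ent P))))) ?_ ?_
  · refine (mk_eq_of_step (.inr (.cons (𝟙 _) s (𝟙 _) hs (.id _) _ _ _ _ _ _ _ _ ?_ ?_ ?_))).symm
    · exact (congrArg (𝟙 _ ≫ ·) (Category.comp_id s)).symm
    · rfl
    · exact .refl _
  · exact mk_cons_id _ _

theorem up_ofEnt {x u : P} (h : M.pair x u) :
    up h ≫ M.ofEnt (EntHom.pair (M.covBy h).1) = 𝟙 (M.obj u) := by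
  let s : (⟨x⟩ : Ent P) ⟶ ⟨u⟩ := EntHom.pair (M.covBy h).1
  have hs : PlusId M.morphisms s := plusId_pair h
  refine Eq.trans (b := LocHom.mk (.cons (𝟙 _) (𝟙 _) (.id _) (.arrow (𝟙 (⟨u⟩ : Ent P))))) ?_ ?_
  · refine mk_eq_of_step (.inr (.cons (𝟙 _) (𝟙 _) s (.id _) hs _ _ _ _ _ _ _ _ rfl rfl ?_))
    refine .arrow _ _ _ ?_
    exact (Category.id_comp s).trans (Category.comp_id s).symm
  · exact mk_cons_id _ _

theorem mk_cons {w x u : P} {z : Ent P} (h : M.pair x u) (g : EntHom w u)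
    (r : LocZigzag M.morphisms ⟨x⟩ z) :
    (show M.obj w ⟶ ⟨z⟩ from LocHom.mk (.cons (w := ⟨w⟩) (y := ⟨u⟩) g
      (EntHom.pair (M.covBy h).1) (plusId_pair h) r)) =
      M.ofEnt g ≫ up h ≫ (show M.obj x ⟶ ⟨z⟩ from LocHom.mk r) := by
  change LocHom.mk _ = LocHom.mk (.cons (w := ⟨w⟩) (y := ⟨u⟩) (g ≫ 𝟙 (⟨u⟩ : Ent P)) _ _
    (LocZigzag.precomp (𝟙 _) r))
  rw [LocZigzag.id_precomp]
  exact congrArg (fun g => LocHom.mk (.cons (w := ⟨w⟩) (y := ⟨u⟩) g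
      (EntHom.pair (M.covBy h).1) (plusId_pair h) r)) g.comp_id.symm

/-! ### Path words -/

/-- `Eval x z L γ`: the word `L` spells a path from `x` to `z`, whose positively oriented letters
are descents and whose negatively oriented letters are reversed matched edges, and the class of this
path in the localization is `γ`. -/
inductive Eval : ∀ (x z : P), List ((P × P) × Bool) → (M.obj x ⟶ M.obj z) → Prop
  | nil (x : P) : Eval x x [] (𝟙 _)
  | pos {x y z : P} {L : List ((P × P) × Bool)} {γ : M.obj y ⟶ M.obj z} (h : y < x)
      (H : Eval y z L γ) : Eval x z (((x, y), true) :: L) (M.ofEnt (EntHom.pair h) ≫ γ)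
  | neg {x u z : P} {L : List ((P × P) × Bool)} {γ : M.obj x ⟶ M.obj z} (h : M.pair x u)
      (H : Eval x z L γ) : Eval u z (((x, u), false) :: L) (up h ≫ γ)

namespace Eval

theorem append {x y z : P} {L L' : List ((P × P) × Bool)} {γ : M.obj x ⟶ M.obj y}
    {γ' : M.obj y ⟶ M.obj z} (H : Eval x y L γ) (H' : Eval y z L' γ') :
    Eval x z (L ++ L') (γ ≫ γ') := by
  induction H with
  | nil x => simpa using H'
  | pos h H ih => rw [Category.assoc]; exact .pos h (ih H')
  | neg h H ih => rw [Category.assoc]; exact .neg h (ih H')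

theorem split {x z : P} {L L' : List ((P × P) × Bool)} {γ : M.obj x ⟶ M.obj z}
    (H : Eval x z (L ++ L') γ) : ∃ (y : P) (γ₁ : M.obj x ⟶ M.obj y) (γ₂ : M.obj y ⟶ M.obj z),
      Eval x y L γ₁ ∧ Eval y z L' γ₂ ∧ γ = γ₁ ≫ γ₂ := by
  induction L generalizing x with
  | nil => exact ⟨x, 𝟙 _, γ, .nil x, H, by simp⟩
  | cons a L ih =>
    cases H with
    | pos h H =>
      obtain ⟨y, γ₁, γ₂, h₁, h₂, rfl⟩ := ih H
      exact ⟨y, _, γ₂, .pos h h₁, h₂, by simp⟩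
    | neg h H =>
      obtain ⟨y, γ₁, γ₂, h₁, h₂, rfl⟩ := ih H
      exact ⟨y, _, γ₂, .neg h h₁, h₂, by simp⟩

theorem unique {x z : P} {L : List ((P × P) × Bool)} {γ γ' : M.obj x ⟶ M.obj z}
    (H : Eval x z L γ) (H' : Eval x z L γ') : γ = γ' := by
  induction H with
  | nil x => cases H'; rfl
  | pos h H ih => cases H' with | pos h' H' => rw [ih H']
  | neg h H ih => cases H' with | neg h' H' => rw [ih H']

theorem ofEnt {x y : P} (g : EntHom x y) : Eval x y (seqWord g.seq) (M.ofEnt g) := by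
  induction g using EntHom.pair_comp_induction with
  | id x => exact .nil x
  | cons h g ih => rw [seqWord_pair_comp]; exact .pos h ih

theorem singleton_up {x u : P} (h : M.pair x u) : Eval u x [((x, u), false)] (up h) := by
  simpa using Eval.neg h (.nil x)

theorem exists_word {x z : P} (γ : M.obj x ⟶ M.obj z) : ∃ L, Eval x z L γ := by
  suffices H : ∀ {w z : Ent P} (τ : LocZigzag M.morphisms w z),
      ∃ L, Eval w.cell z.cell L (LocHom.mk τ) by
    induction γ using Quotient.inductionOn with | h τ => exact H τ
  intro w z τ
  induction τ with
  | arrow g => exact ⟨_, .ofEnt g⟩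
  | @cons w y x z g f hf r ih =>
    obtain ⟨L, hL⟩ := ih
    cases hf with
    | of f hf =>
      obtain ⟨h, h', rfl⟩ := hf
      have := ((Eval.ofEnt (M := M) g).append ((singleton_up h).append hL))
      exact ⟨_, Eq.mp (congrArg (Eval _ _ _) (mk_cons h g r).symm) this⟩
    | id =>
      have := (Eval.ofEnt (M := M) g).append hL
      exact ⟨_, Eq.mp (congrArg (Eval _ _ _) (mk_cons_id g r).symm) this⟩

theorem of_cancel {x z : P} {e : P × P} {b : Bool} {L : List ((P × P) × Bool)}
    {γ : M.obj x ⟶ M.obj z} (H : Eval x z ((e, b) :: (e, !b) :: L) γ) : Eval x z L γ := by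
  cases H with
  | pos h H =>
    cases H with
    | neg h' H => rw [← Category.assoc, ofEnt_up h', Category.id_comp]; exact H
  | neg h H =>
    cases H with
    | pos h' H => rw [← Category.assoc, up_ofEnt h, Category.id_comp]; exact H

theorem of_step {x z : P} {L L' : List ((P × P) × Bool)} {γ : M.obj x ⟶ M.obj z}
    (H : Eval x z L γ) (h : FreeGroup.Red.Step L L') : Eval x z L' γ := by
  cases h with
  | @not L₁ L₂ e b =>
    obtain ⟨y, γ₁, γ₂, h₁, h₂, rfl⟩ := H.split
    exact h₁.append h₂.of_cancel

theorem of_red {x z : P} {L L' : List ((P × P) × Bool)} {γ : M.obj x ⟶ M.obj z}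
    (H : Eval x z L γ) (h : FreeGroup.Red L L') : Eval x z L' γ := by
  induction h with
  | refl => exact H
  | tail _ h ih => exact ih.of_step h

theorem exists_isReduced {x z : P} (γ : M.obj x ⟶ M.obj z) :
    ∃ L, Eval x z L γ ∧ FreeGroup.IsReduced L := by
  obtain ⟨L, hL, hmin⟩ := exists_minimal_of_wellFoundedLT (fun n => ∃ L, Eval x z L γ ∧ L.length = n)
    ((exists_word γ).imp' _ fun L hL => ⟨L, hL, rfl⟩)
  obtain ⟨L, hL, rfl⟩ := hL
  refine ⟨L, hL, FreeGroup.isReduced_iff_not_step.2 fun L' h => ?_⟩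
  have h1 := h.length
  have := hmin ⟨L', hL.of_step h, rfl⟩ (by omega)
  omega

end Eval

/-! ### The class of a path in the free group -/

/-- The class in the free group of an entrance path. -/
def entGroup {x y : Ent P} (g : x ⟶ y) : FreeGroup (P × P) := FreeGroup.mk (seqWord (EntHom.seq g))

theorem entGroup_comp {x y z : Ent P} (f : x ⟶ y) (g : y ⟶ z) :
    entGroup (f ≫ g) = entGroup f * entGroup g := by
  rw [entGroup, entGroup, entGroup, FreeGroup.mul_mk]
  exact congrArg _ (seqWord_comp _ _)

theorem entGroup_id (x : Ent P) : entGroup (𝟙 x) = 1 := rfl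

/-- The class in the free group of a zigzag. -/
def zigzagGroup : ∀ {x y : Ent P}, LocZigzag M.morphisms x y → FreeGroup (P × P)
  | _, _, .arrow g => entGroup g
  | _, _, .cons g f _ r => entGroup g * (entGroup f)⁻¹ * zigzagGroup r

theorem zigzagGroup_precomp {w x y : Ent P} (g : w ⟶ x) (r : LocZigzag M.morphisms x y) :
    zigzagGroup (r.precomp g) = entGroup g * zigzagGroup r := by
  cases r <;> simp [LocZigzag.precomp, zigzagGroup, entGroup_comp, mul_assoc]

theorem zigzagGroup_append {w x y : Ent P} (r : LocZigzag M.morphisms w x)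
    (s : LocZigzag M.morphisms x y) :
    zigzagGroup (r.append s) = zigzagGroup r * zigzagGroup s := by
  induction r with
  | arrow g => exact zigzagGroup_precomp g s
  | cons g f hf r ih => simp [LocZigzag.append, zigzagGroup, ih, mul_assoc]

theorem zigzagGroup_verticalFrom {w w' z : Ent P} {v : w ⟶ w'} {τ : LocZigzag M.morphisms w z}
    {τ' : LocZigzag M.morphisms w' z} (H : LocZigzag.VerticalFrom v τ τ') :
    zigzagGroup τ = entGroup v * zigzagGroup τ' := by
  induction H with
  | arrow v g g' hg => simp [zigzagGroup, hg, entGroup_comp]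
  | cons v u v₁ hu hv₁ g f hf r g' f' hf' r' hg hfu hr ih =>
    have h1 := congrArg entGroup hg
    have h2 := congrArg entGroup hfu
    rw [entGroup_comp, entGroup_comp] at h1 h2
    have h3 : entGroup g = entGroup v * entGroup g' * (entGroup u)⁻¹ := by rw [← h1]; group
    have h4 : entGroup f = entGroup v₁ * entGroup f' * (entGroup u)⁻¹ := by rw [← h2]; group
    simp only [zigzagGroup, ih, h3, h4]
    group

theorem zigzagGroup_horizontal {w z : Ent P} {τ τ' : LocZigzag M.morphisms w z}
    (H : LocZigzag.Horizontal τ τ') : zigzagGroup τ = zigzagGroup τ' := by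
  induction H with
  | remove g r => simp [zigzagGroup, zigzagGroup_precomp, entGroup_id]
  | cons g f hf H ih => simp [zigzagGroup, ih]

/-- The class in the free group of a morphism of the localization. -/
def homGroup {x z : P} (γ : M.obj x ⟶ M.obj z) : FreeGroup (P × P) :=
  Quotient.lift zigzagGroup (fun τ τ' (h : Relation.EqvGen _ τ τ') => by
    induction h with
    | rel τ τ' h =>
      rcases h with h | h
      · exact zigzagGroup_horizontal h
      · simpa [entGroup_id] using zigzagGroup_verticalFrom h
    | refl τ => rfl
    | symm _ _ _ ih => exact ih.symm
    | trans _ _ _ _ _ ih ih' => exact ih.trans ih') γ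

theorem homGroup_comp {x y z : P} (γ : M.obj x ⟶ M.obj y) (δ : M.obj y ⟶ M.obj z) :
    homGroup (γ ≫ δ) = homGroup γ * homGroup δ := by
  induction γ using Quotient.inductionOn with
  | h τ =>
    induction δ using Quotient.inductionOn with
    | h τ' => exact zigzagGroup_append τ τ'

/-- All path words of a morphism have the same class in the free group. -/
theorem Eval.homGroup_eq {x z : P} {L : List ((P × P) × Bool)} {γ : M.obj x ⟶ M.obj z}
    (H : Eval x z L γ) : homGroup γ = FreeGroup.mk L := by
  induction H with
  | nil x => rfl
  | pos h H ih => rw [homGroup_comp, ih]; rfl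
  | neg h H ih =>
    rw [homGroup_comp, ih]
    rw [← List.singleton_append, ← FreeGroup.mul_mk]
    congr 1

end AcyclicMatching

/-! ### Refinement of words -/

section Refines

variable {P : Type u} [PartialOrder P]

/-- Entrance paths are ordered by the subsequence relation. -/
instance EntHom.instPartialOrder (x y : P) : PartialOrder (EntHom x y) :=
  PCategory.homOrder (⟨x⟩ : Ent P) ⟨y⟩

theorem EntHom.le_iff_sublist {x y : P} {f g : EntHom x y} : f ≤ g ↔ f.seq.Sublist g.seq := Iff.rfl

theorem EntHom.comp_le_comp {x y z : P} {f f' : EntHom x y} {g g' : EntHom y z} (hf : f ≤ f')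
    (hg : g ≤ g') : f.comp g ≤ f'.comp g' :=
  PCategory.comp_mono (C := Ent P) (a := ⟨x⟩) (b := ⟨y⟩) (c := ⟨z⟩) f f' g g' hf hg

theorem EntHom.pair_le {x y : P} (h : y < x) (g : EntHom x y) : pair h ≤ g := g.pair_sublist h

/-- `Refines L L'`: the word `L'` arises from `L` by replacing every positively oriented letter
`x > y` by an entrance path from `x` to `y`. -/
inductive Refines : List ((P × P) × Bool) → List ((P × P) × Bool) → Prop
  | nil : Refines [] []
  | pos {x y : P} (g : EntHom x y) {L L' : List ((P × P) × Bool)} (H : Refines L L') :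
      Refines (((x, y), true) :: L) (seqWord g.seq ++ L')
  | neg (e : P × P) {L L' : List ((P × P) × Bool)} (H : Refines L L') :
      Refines ((e, false) :: L) ((e, false) :: L')

namespace Refines

theorem append {A A' B B' : List ((P × P) × Bool)} (HA : Refines A A') (HB : Refines B B') :
    Refines (A ++ B) (A' ++ B') := by
  induction HA with
  | nil => exact HB
  | pos g H ih => simpa using Refines.pos g ih
  | neg e H ih => exact .neg e ih

theorem exists_of_append {A B K : List ((P × P) × Bool)} (H : Refines (A ++ B) K) :
    ∃ A' B', Refines A A' ∧ Refines B B' ∧ K = A' ++ B' := by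
  induction A generalizing K with
  | nil => exact ⟨[], K, .nil, H, rfl⟩
  | cons a A ih =>
    cases H with
    | pos g H =>
      obtain ⟨A', B', hA, hB, rfl⟩ := ih H
      exact ⟨_, B', .pos g hA, hB, by simp⟩
    | neg e H =>
      obtain ⟨A', B', hA, hB, rfl⟩ := ih H
      exact ⟨_, B', .neg e hA, hB, by simp⟩

theorem exists_of_seqWord {x y : P} {f : EntHom x y} {K : List ((P × P) × Bool)}
    (H : Refines (seqWord f.seq) K) : ∃ g : EntHom x y, f ≤ g ∧ K = seqWord g.seq := by
  induction f using EntHom.pair_comp_induction generalizing K with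
  | id x => cases H; exact ⟨EntHom.id x, le_rfl, rfl⟩
  | cons h f ih =>
    rw [seqWord_pair_comp] at H
    cases H with
    | pos g H =>
      obtain ⟨f', hf, rfl⟩ := ih H
      exact ⟨g.comp f', EntHom.comp_le_comp (EntHom.pair_le h g) hf, (seqWord_comp _ _).symm⟩

theorem trans {A B C : List ((P × P) × Bool)} (H : Refines A B) (H' : Refines B C) :
    Refines A C := by
  induction H generalizing C with
  | nil => exact H'
  | pos g H ih =>
    obtain ⟨A', B', hA, hB, rfl⟩ := H'.exists_of_append
    obtain ⟨g', -, rfl⟩ := hA.exists_of_seqWord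
    exact .pos g' (ih hB)
  | neg e H ih => cases H' with | neg _ H' => exact .neg e (ih H')

end Refines

theorem EntHom.exists_comp_of_mem {x y z : P} (g : EntHom x z) {l : List P}
    (h : (y :: l).Sublist g.seq) :
    ∃ (g₁ : EntHom x y) (g₂ : EntHom y z), g = g₁.comp g₂ ∧ (y :: l).Sublist g₂.seq := by
  induction g using EntHom.pair_comp_induction with
  | id x =>
    have := h.subset (List.mem_cons_self)
    obtain rfl : y = x := by simpa [EntHom.id] using this
    exact ⟨EntHom.id y, EntHom.id y, (EntHom.comp_id _).symm, h⟩
  | @cons x a z ha g ih =>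
    rw [pair_comp_seq] at h
    cases h with
    | cons _ h =>
      obtain ⟨g₁, g₂, rfl, h2⟩ := ih h
      exact ⟨(pair ha).comp g₁, g₂, (EntHom.comp_assoc _ _ _).symm, h2⟩
    | cons_cons _ h =>
      refine ⟨EntHom.id y, (pair ha).comp g, (EntHom.id_comp _).symm, ?_⟩
      rw [pair_comp_seq]
      exact h.cons_cons y

theorem Refines.seqWord {x y : P} {f g : EntHom x y} (h : f ≤ g) :
    Refines (seqWord f.seq) (seqWord g.seq) := by
  induction f using EntHom.pair_comp_induction with
  | id x => rw [g.eq_id]; exact .nil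
  | @cons x a z ha f ih =>
    obtain ⟨b, hb, g, rfl⟩ := g.exists_eq_pair_comp (f.le.trans_lt ha)
    have hs := EntHom.le_iff_sublist.1 h
    rw [EntHom.pair_comp_seq, EntHom.pair_comp_seq, List.cons_sublist_cons, f.seq_eq_cons] at hs
    obtain ⟨g₁, g₂, rfl, h2⟩ := g.exists_comp_of_mem hs
    rw [← f.seq_eq_cons] at h2
    rw [← EntHom.comp_assoc, seqWord_comp _ g₂, seqWord_pair_comp]
    exact .pos _ (ih h2)

end Refines

namespace AcyclicMatching

variable {P : Type u} [PartialOrder P] {M : AcyclicMatching P}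

theorem Eval.refines_refl {x z : P} {L : List ((P × P) × Bool)} {γ : M.obj x ⟶ M.obj z}
    (H : Eval x z L γ) : Refines L L := by
  induction H with
  | nil x => exact .nil
  | pos h H ih => exact .pos (EntHom.pair h) ih
  | neg h H ih => exact .neg _ ih

theorem Eval.lt {x z : P} {L : List ((P × P) × Bool)} {γ : M.obj x ⟶ M.obj z}
    (H : Eval x z L γ) : ∀ l ∈ L, l.1.2 < l.1.1 := by
  induction H with
  | nil x => simp
  | pos h H ih => exact List.forall_mem_cons.2 ⟨h, ih⟩
  | neg h H ih => exact List.forall_mem_cons.2 ⟨(M.covBy h).1, ih⟩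

theorem Eval.exists_of_refines {x z : P} {L L' : List ((P × P) × Bool)} {γ : M.obj x ⟶ M.obj z}
    (H : Eval x z L γ) (h : Refines L L') : ∃ γ' : M.obj x ⟶ M.obj z, Eval x z L' γ' := by
  induction H generalizing L' with
  | nil x => cases h; exact ⟨_, .nil x⟩
  | pos h' H ih =>
    cases h with
    | pos g h =>
      obtain ⟨γ', h2⟩ := ih h
      exact ⟨_, (Eval.ofEnt g).append h2⟩
  | neg h' H ih =>
    cases h with
    | neg g h =>
      obtain ⟨γ', h2⟩ := ih h
      exact ⟨_, .neg h' h2⟩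

/-! ### The order on morphisms of the localization -/

/-- `Below γ γ'`: some path word of `γ'` refines some path word of `γ`. -/
def Below {x z : P} (γ γ' : M.obj x ⟶ M.obj z) : Prop :=
  ∃ L L', Eval x z L γ ∧ Eval x z L' γ' ∧ Refines L L'

/-- Matched edges cannot be refined, so a cancelling pair of letters survives refinement. -/
theorem Eval.exists_of_refines_cancel {x z : P} {e : P × P} {b : Bool}
    {L K : List ((P × P) × Bool)} {γ : M.obj x ⟶ M.obj z}
    (H : Eval x z ((e, b) :: (e, !b) :: L) γ) (h : Refines ((e, b) :: (e, !b) :: L) K) :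
    ∃ L', K = (e, b) :: (e, !b) :: L' ∧ Refines L L' := by
  cases H with
  | pos h₁ H =>
    cases H with
    | neg h₂ H =>
      cases h with
      | pos g h =>
        rw [g.eq_pair_of_covBy (M.covBy h₂)]
        cases h with | neg _ h => exact ⟨_, rfl, h⟩
  | neg h₁ H =>
    cases H with
    | pos h₂ H =>
      cases h with
      | neg _ h =>
        cases h with
        | pos g h =>
          rw [g.eq_pair_of_covBy (M.covBy h₁)]
          exact ⟨_, rfl, h⟩

theorem Eval.refines_step {x z : P} {L L' K : List ((P × P) × Bool)} {γ : M.obj x ⟶ M.obj z}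
    (H : Eval x z L γ) (h : FreeGroup.Red.Step L L') (hK : Refines L K) :
    ∃ K', Refines L' K' ∧ FreeGroup.Red.Step K K' := by
  cases h with
  | @not A B e b =>
    obtain ⟨A', B', hA, hB, rfl⟩ := hK.exists_of_append
    obtain ⟨y, γ₁, γ₂, h₁, h₂, rfl⟩ := H.split
    obtain ⟨C, rfl, hC⟩ := h₂.exists_of_refines_cancel hB
    exact ⟨_, hA.append hC, .not⟩

theorem Eval.refines_step_symm {x z : P} {L L' K' : List ((P × P) × Bool)}
    {γ : M.obj x ⟶ M.obj z} (H : Eval x z L γ) (h : FreeGroup.Red.Step L L')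
    (hK : Refines L' K') : ∃ K, Refines L K ∧ FreeGroup.Red.Step K K' := by
  cases h with
  | @not A B e b =>
    obtain ⟨A', B', hA, hB, rfl⟩ := hK.exists_of_append
    obtain ⟨y, γ₁, γ₂, h₁, h₂, rfl⟩ := H.split
    have h3 : Refines [(e, b), (e, !b)] [(e, b), (e, !b)] := by
      have h4 := h₂.refines_refl
      rw [← List.singleton_append, ← List.singleton_append (l := B), ← List.append_assoc] at h₂
      obtain ⟨_, _, _, h5, _⟩ := h₂.split
      exact h5.refines_refl
    exact ⟨A' ++ ([(e, b), (e, !b)] ++ B'), hA.append (h3.append hB), .not⟩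

theorem Eval.refines_red {x z : P} {L L' K : List ((P × P) × Bool)} {γ : M.obj x ⟶ M.obj z}
    (H : Eval x z L γ) (h : FreeGroup.Red L L') (hK : Refines L K) :
    ∃ K', Refines L' K' ∧ FreeGroup.Red K K' := by
  induction h with
  | refl => exact ⟨K, hK, .refl⟩
  | tail h h' ih =>
    obtain ⟨K', h1, h2⟩ := ih
    obtain ⟨K'', h3, h4⟩ := (H.of_red h).refines_step h' h1
    exact ⟨K'', h3, .tail h2 h4⟩

theorem Eval.refines_red_symm {x z : P} {L L' K' : List ((P × P) × Bool)}
    {γ : M.obj x ⟶ M.obj z} (H : Eval x z L γ) (h : FreeGroup.Red L L') (hK : Refines L' K') :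
    ∃ K, Refines L K ∧ FreeGroup.Red K K' := by
  induction h generalizing K' with
  | refl => exact ⟨K', hK, .refl⟩
  | tail h h' ih =>
    obtain ⟨K'', h3, h4⟩ := (H.of_red h).refines_step_symm h' hK
    obtain ⟨K, h1, h2⟩ := ih h3
    exact ⟨K, h1, .tail h2 h4⟩

/-- Whether `γ'` lies above `γ` can be tested on any path word of `γ`. -/
theorem Below.exists_refines {x z : P} {γ γ' : M.obj x ⟶ M.obj z} (h : Below γ γ')
    {K : List ((P × P) × Bool)} (hK : Eval x z K γ) : ∃ K', Refines K K' ∧ Eval x z K' γ' := by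
  obtain ⟨L, L', hL, hL', hr⟩ := h
  obtain ⟨N, hN1, hN2⟩ := FreeGroup.Red.exact.1 (hL.homGroup_eq.symm.trans hK.homGroup_eq)
  obtain ⟨N', h1, h2⟩ := hL.refines_red hN1 hr
  obtain ⟨K', h3, h4⟩ := hK.refines_red_symm hN2 h1
  obtain ⟨γ'', h5⟩ := hK.exists_of_refines h3
  obtain rfl := (h5.of_red h4).unique (hL'.of_red h2)
  exact ⟨K', h3, h5⟩

theorem Below.refl {x z : P} (γ : M.obj x ⟶ M.obj z) : Below γ γ := by
  obtain ⟨L, hL⟩ := Eval.exists_word γ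
  exact ⟨L, L, hL, hL, hL.refines_refl⟩

theorem Below.trans {x z : P} {γ γ' γ'' : M.obj x ⟶ M.obj z} (h : Below γ γ')
    (h' : Below γ' γ'') : Below γ γ'' := by
  obtain ⟨L, L', hL, hL', hr⟩ := h
  obtain ⟨L'', hr', hL''⟩ := h'.exists_refines hL'
  exact ⟨L, L'', hL, hL'', hr.trans hr'⟩

theorem Below.comp {x y z : P} {γ γ' : M.obj x ⟶ M.obj y} {δ δ' : M.obj y ⟶ M.obj z}
    (h : Below γ γ') (h' : Below δ δ') : Below (γ ≫ δ) (γ' ≫ δ') := by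
  obtain ⟨L, L', hL, hL', hr⟩ := h
  obtain ⟨K, K', hK, hK', hr'⟩ := h'
  exact ⟨_, _, hL.append hK, hL'.append hK', hr.append hr'⟩

theorem Below.ofEnt {x y : P} {f g : EntHom x y} (h : f ≤ g) :
    Below (M.ofEnt f) (M.ofEnt g) :=
  ⟨_, _, .ofEnt f, .ofEnt g, .seqWord h⟩

/-! ### Comparison with ladders -/

/-- The squares of a ladder involving a left-pointing arrow commute: no two matched edges are
composable, so the composites are at most single edges. -/
theorem plusId_square {x x' y y' : Ent P} {v : x ⟶ x'} {f' : x' ⟶ y'} {f : x ⟶ y} {u : y ⟶ y'}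
    (hf : PlusId M.morphisms f) (hu : PlusId M.morphisms u) (h : v ≫ f' ≤ f ≫ u) :
    v ≫ f' = f ≫ u := by
  suffices H : ∀ k : x ⟶ y', (k = f ≫ u) → ∀ k' : x ⟶ y', k' ≤ k → k' = k from H _ rfl _ h
  intro k hk k' hle
  have key : (∃ e : x = y', k = eqToHom e) ∨ ∃ h : y'.cell ⋖ x.cell, k = EntHom.pair h.1 := by
    cases hf with
    | of f hf =>
      obtain ⟨h1, h2, rfl⟩ := hf
      cases hu with
      | of u hu => exact absurd hu.1 (M.not_pair h1)
      | id => right; exact ⟨M.covBy h1, hk.trans (Category.comp_id (obj := Ent P) _)⟩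
    | id =>
      rw [Category.id_comp] at hk
      subst hk
      cases hu with
      | of u hu => right; obtain ⟨h1, h2, h3⟩ := hu; exact ⟨M.covBy h1, h3⟩
      | id => left; exact ⟨rfl, rfl⟩
  rcases key with ⟨rfl, rfl⟩ | ⟨h, rfl⟩
  · exact EntHom.eq_id k'
  · exact EntHom.eq_pair_of_covBy h k'

/-- The morphism of the localization given by a morphism of the entrance path category. -/
abbrev ofHom {x y : Ent P} (g : x ⟶ y) : M.obj x.cell ⟶ M.obj y.cell := M.ofEnt g

theorem ofHom_id (x : Ent P) : (ofHom (𝟙 x) : M.obj x.cell ⟶ M.obj x.cell) = 𝟙 _ := rfl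

/-- The class of a zigzag, as a morphism of the localization. -/
abbrev ofZigzag {x y : Ent P} (τ : LocZigzag M.morphisms x y) : M.obj x.cell ⟶ M.obj y.cell :=
  LocHom.mk τ

/-- The left-pointing arrow of a zigzag becomes invertible, and the zigzag evaluates to a composite
with its inverse. -/
theorem exists_inv_of_plusId {x y : Ent P} {f : x ⟶ y} (hf : PlusId M.morphisms f) :
    ∃ i : M.obj y.cell ⟶ M.obj x.cell, ofHom f ≫ i = 𝟙 _ ∧ i ≫ ofHom f = 𝟙 _ ∧
      ∀ {w z : Ent P} (g : w ⟶ y) (r : LocZigzag M.morphisms x z),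
        ofZigzag (.cons g f hf r) = ofHom g ≫ i ≫ ofZigzag r := by
  cases hf with
  | of f hf =>
    obtain ⟨h, h', rfl⟩ := hf
    exact ⟨up h, ofEnt_up h, up_ofEnt h, fun g r => mk_cons h g r⟩
  | id =>
    refine ⟨𝟙 _, Category.comp_id _, Category.comp_id _, fun g r => ?_⟩
    rw [Category.id_comp]
    exact mk_cons_id g r

theorem Below.of_ladderFrom {w w' z : Ent P} {v : w ⟶ w'} {τ : LocZigzag M.morphisms w z}
    {τ' : LocZigzag M.morphisms w' z} (H : LocZigzag.LadderFrom v τ τ') :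
    Below (x := w.cell) (z := z.cell)
      (ofHom v ≫ ofZigzag τ') (ofZigzag τ) := by
  induction H with
  | arrow v g g' hg => exact Below.ofEnt (M := M) hg
  | cons v u v₁ hu hv₁ g f hf r g' f' hf' r' hg hfu hr ih =>
    obtain ⟨i, hi1, hi2, hi⟩ := exists_inv_of_plusId hf
    obtain ⟨i', hi1', hi2', hi'⟩ := exists_inv_of_plusId hf'
    obtain ⟨j, hj1, hj2, -⟩ := exists_inv_of_plusId hu
    have e1 : (ofHom v₁ ≫ ofHom f' : M.obj _ ⟶ M.obj _) = ofHom f ≫ ofHom u :=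
      congrArg (fun k => ofHom k) (plusId_square hf hu hfu)
    have e2 : i' = j ≫ i ≫ ofHom v₁ := by
      calc i' = j ≫ (i ≫ ofHom f) ≫ ofHom u ≫ i' := by
            rw [hi2, Category.id_comp, ← Category.assoc, hj2, Category.id_comp]
        _ = j ≫ i ≫ (ofHom f ≫ ofHom u) ≫ i' := by simp only [Category.assoc]
        _ = j ≫ i ≫ (ofHom v₁ ≫ ofHom f') ≫ i' := by rw [e1]
        _ = j ≫ i ≫ ofHom v₁ := by rw [Category.assoc, hi1', Category.comp_id]
    have hlow := Below.ofEnt (M := M) hg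
    have hcomp := hlow.comp ((Below.refl (j ≫ i)).comp ih)
    have t1 : M.ofEnt (EntHom.comp v g') ≫ (j ≫ i) ≫ ofHom v₁ ≫ ofZigzag r' =
        ofHom v ≫ ofZigzag (.cons g' f' hf' r') := by
      rw [hi', e2, ofEnt_comp]
      simp only [Category.assoc]
    have t2 : M.ofEnt (EntHom.comp g u) ≫ (j ≫ i) ≫ ofZigzag r =
        ofZigzag (.cons g f hf r) := by
      rw [hi, ofEnt_comp]
      simp only [Category.assoc]
      rw [← Category.assoc (M.ofEnt u), hj1, Category.id_comp]
    rw [← t1, ← t2]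
    exact hcomp

theorem ladderFrom_precomp {a w z : Ent P} {h h' : a ⟶ w} (hh : h' ≤ h)
    {τ τ' : LocZigzag M.morphisms w z} (H : LocZigzag.LadderFrom (𝟙 w) τ τ') :
    LocZigzag.LadderFrom (𝟙 a) (τ.precomp h) (τ'.precomp h') := by
  generalize hv : 𝟙 w = v at H
  cases H with
  | arrow v g g' hg =>
    subst hv
    refine .arrow _ _ _ ?_
    rw [Category.id_comp] at hg ⊢
    exact PCategory.comp_mono _ _ _ _ hh hg
  | cons v u v₁ hu hv₁ g f hf r g' f' hf' r' hg hfu hr =>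
    subst hv
    refine .cons _ u v₁ hu hv₁ _ _ _ _ _ _ _ _ ?_ hfu hr
    rw [Category.id_comp] at hg ⊢
    rw [Category.assoc]
    exact PCategory.comp_mono _ _ _ _ hh hg

theorem Eval.exists_ladderFrom {x z : P} {L L' : List ((P × P) × Bool)}
    {γ γ' : M.obj x ⟶ M.obj z} (H : Eval x z L γ) (H' : Eval x z L' γ') (h : Refines L L') :
    ∃ τ τ' : LocZigzag M.morphisms ⟨x⟩ ⟨z⟩, LocHom.mk τ = γ' ∧ LocHom.mk τ' = γ ∧
      LocZigzag.LadderFrom (𝟙 _) τ τ' := by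
  induction H generalizing L' with
  | nil x =>
    cases h
    cases H'
    exact ⟨.arrow (𝟙 _), .arrow (𝟙 _), rfl, rfl, .arrow _ _ _ (by simp)⟩
  | @pos x y z L γ hyx H ih =>
    cases h with
    | pos g h =>
      obtain ⟨δ, hδ⟩ := H.exists_of_refines h
      obtain ⟨τ, τ', rfl, rfl, hl⟩ := ih hδ h
      obtain rfl := ((Eval.ofEnt g).append hδ).unique H'
      exact ⟨_, _, rfl, rfl, ladderFrom_precomp (EntHom.pair_le hyx g) hl⟩
  | @neg x u z L γ hxu H ih =>
    cases h with
    | neg _ h =>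
      cases H' with
      | neg hxu H' =>
        obtain ⟨τ, τ', rfl, rfl, hl⟩ := ih H' h
        let i : (⟨u⟩ : Ent P) ⟶ ⟨u⟩ := 𝟙 _
        refine ⟨.cons i _ (plusId_pair hxu) τ, .cons i _ (plusId_pair hxu) τ', ?_, ?_, ?_⟩
        · exact (mk_cons hxu (EntHom.id u) τ).trans (Category.id_comp _)
        · exact (mk_cons hxu (EntHom.id u) τ').trans (Category.id_comp _)
        · refine .cons _ (𝟙 _) (𝟙 _) (.id _) (.id _) _ _ _ _ _ _ _ _ ?_ ?_ hl
          · exact le_rfl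
          · rw [Category.id_comp, Category.comp_id]

/-- The relation `⇒` on the localization is refinement of path words. -/
theorem below_iff_implies {x z : P} {γ γ' : M.obj x ⟶ M.obj z} :
    Below γ γ' ↔ LocHom.Implies (S := M.morphisms) (w := ⟨x⟩) (z := ⟨z⟩) γ γ' := by
  constructor
  · rintro ⟨L, L', hL, hL', h⟩
    obtain ⟨τ, τ', h1, h2, h3⟩ := hL.exists_ladderFrom hL' h
    exact ⟨τ, τ', h1, h2, h3⟩
  · rintro ⟨τ, τ', rfl, rfl, h⟩
    have := Below.of_ladderFrom h
    rw [ofHom_id, Category.id_comp] at this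
    exact this

end AcyclicMatching

/-! ### Uniqueness of refinements -/

section Words

variable {P : Type u}

/-- The exponent sum of the letter `e` in an element of the free group. -/
noncomputable def exponentSum (e : P × P) : FreeGroup (P × P) →* Multiplicative ℤ := by
  classical
  exact FreeGroup.lift fun e' => if e' = e then Multiplicative.ofAdd 1 else 1

theorem exponentSum_mk_eq_one {e : P × P} {L : List ((P × P) × Bool)} (h : ∀ l ∈ L, l.1 ≠ e) :
    exponentSum e (FreeGroup.mk L) = 1 := by
  classical
  rw [exponentSum, FreeGroup.lift_mk]
  refine List.prod_eq_one fun a ha => ?_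
  obtain ⟨l, hl, rfl⟩ := List.mem_map.1 ha
  simp [h l hl]

theorem mk_cons_true (e : P × P) (L : List ((P × P) × Bool)) :
    FreeGroup.mk ((e, true) :: L) = FreeGroup.of e * FreeGroup.mk L := by
  rw [FreeGroup.of, FreeGroup.mul_mk]; rfl

theorem mk_cons_false (e : P × P) (L : List ((P × P) × Bool)) :
    FreeGroup.mk ((e, false) :: L) = (FreeGroup.of e)⁻¹ * FreeGroup.mk L := by
  rw [FreeGroup.of, FreeGroup.inv_mk, FreeGroup.mul_mk]; rfl

/-- The total number of intermediate dimensions skipped by the letters of a word, where `c` is the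
dimension function. Matched edges, and hence all negative letters, contribute nothing. -/
def wordDim (c : P → ℤ) (L : List ((P × P) × Bool)) : ℤ :=
  (L.map fun l => c l.1.1 - c l.1.2 - 1).sum

theorem wordDim_append (c : P → ℤ) (L L' : List ((P × P) × Bool)) :
    wordDim c (L ++ L') = wordDim c L + wordDim c L' := by
  simp [wordDim]

variable [PartialOrder P]

theorem fst_fst_le_of_mem_seqWord {x y : P} {g : EntHom x y} {l : (P × P) × Bool}
    (hl : l ∈ seqWord g.seq) : l.1.1 ≤ x := by
  induction g using EntHom.pair_comp_induction with
  | id x => simp [seqWord_id] at hl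
  | cons h g ih =>
    rw [seqWord_pair_comp, List.mem_cons] at hl
    rcases hl with rfl | hl
    · exact le_rfl
    · exact (ih hl).trans h.le

end Words

namespace AcyclicMatching

variable {P : Type u} [PartialOrder P] {M : AcyclicMatching P}

/-- The rank drops along reduced path words, and along their refinements. -/
theorem Eval.rank_bounds {m z : P} {L : List ((P × P) × Bool)} {γ : M.obj m ⟶ M.obj z}
    (H : Eval m z L γ) (hL : FreeGroup.IsReduced L) :
    (∀ x, m < x → L.head? ≠ some ((x, m), false) →
      ∀ L', Refines L L' → ∀ l ∈ L', M.rank l.1.1 < M.rank x) ∧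
    ((∀ e, L.head? ≠ some (e, false)) →
      ∀ L', Refines L L' → ∀ l ∈ L', M.rank l.1.1 ≤ M.rank m) := by
  induction H with
  | nil x =>
    refine ⟨fun x _ _ L' hL' => ?_, fun _ L' hL' => ?_⟩ <;> cases hL' <;> simp
  | @pos m y z L γ h H ih =>
    have hL' : FreeGroup.IsReduced L := hL.tail
    have hhead : ∀ e : P × P, e = (m, y) → L.head? ≠ some (e, false) := by
      rintro e rfl h'
      cases L with
      | nil => simp at h'
      | cons a L =>
        obtain rfl : a = ((m, y), false) := by simpa using h'
        simpa using (FreeGroup.isReduced_cons_cons.1 hL).1 rfl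
    have h2 := (ih hL').1
    constructor
    · intro x hx _ K hK l hl
      cases hK with
      | pos g hK =>
        rcases List.mem_append.1 hl with hl | hl
        · exact M.rank_strictMono ((fst_fst_le_of_mem_seqWord hl).trans_lt hx)
        · refine h2 x (h.trans hx) (fun h' => ?_) _ hK l hl
          have h3 : M.pair x y := by
            cases H with
            | nil => simp at h'
            | pos _ _ => simp at h'
            | neg h4 _ =>
              obtain ⟨rfl, -⟩ : _ = x ∧ True := by simpa using h'
              exact h4
          exact (M.covBy h3).2 h hx
    · intro _ K hK l hl
      cases hK with
      | pos g hK =>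
        rcases List.mem_append.1 hl with hl | hl
        · exact M.rank_strictMono.monotone (fst_fst_le_of_mem_seqWord hl)
        · exact (h2 m h (hhead _ rfl) _ hK l hl).le
  | @neg x' m z L γ h H ih =>
    have hL' : FreeGroup.IsReduced L := hL.tail
    constructor
    · intro x hx hne K hK l hl
      have hx' : x' ≠ x := by rintro rfl; simp at hne
      have hlt : M.rank x' < M.rank x :=
        M.rank_lt hx (fun h' => hx' (M.upper_unique h h')) h
      cases hK with
      | neg _ hK =>
        rcases List.mem_cons.1 hl with rfl | hl
        · exact hlt
        · refine ((ih hL').2 (fun e h' => ?_) _ hK l hl).trans_lt hlt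
          cases H with
          | nil => simp at h'
          | pos _ _ => simp at h'
          | neg h4 _ => exact M.not_pair h4 h
    · intro h'
      simp at h'

/-- Refinements of `(x > y)` followed by a reduced word are told apart by the free group: the first
letter in which the two paths from `x` to `y` differ cannot recur further on, as the rank drops. -/
theorem Eval.eq_of_mk_seqWord_append {x y z : P} {L R₁ R₂ : List ((P × P) × Bool)}
    {γ : M.obj y ⟶ M.obj z} (H : Eval y z L γ) (hL : FreeGroup.IsReduced L) (h₁ : Refines L R₁)
    (h₂ : Refines L R₂) {f g : EntHom x y}
    (h : FreeGroup.mk (seqWord f.seq ++ R₁) = FreeGroup.mk (seqWord g.seq ++ R₂)) :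
    f = g ∧ FreeGroup.mk R₁ = FreeGroup.mk R₂ := by
  induction f using EntHom.pair_comp_induction with
  | id x => rw [g.eq_id] at h ⊢; exact ⟨rfl, h⟩
  | @cons x a y ha f ih =>
    obtain ⟨b, hb, g, rfl⟩ := g.exists_eq_pair_comp (f.le.trans_lt ha)
    rw [seqWord_pair_comp, seqWord_pair_comp, List.cons_append, List.cons_append] at h
    by_cases hab : a = b
    · subst hab
      rw [mk_cons_true, mk_cons_true] at h
      obtain ⟨rfl, h'⟩ := ih H (mul_left_cancel h)
      exact ⟨rfl, h'⟩
    · exfalso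
      have hhead : L.head? ≠ some ((x, y), false) := by
        intro h'
        cases H with
        | nil => simp at h'
        | pos _ _ => simp at h'
        | neg h4 _ =>
          obtain ⟨rfl, -⟩ : _ = x ∧ True := by simpa using h'
          have ha' := ((M.covBy h4).eq_or_eq f.le ha.le).resolve_right ha.ne
          have hb' := ((M.covBy h4).eq_or_eq g.le hb.le).resolve_right hb.ne
          exact hab (ha'.trans hb'.symm)
      have hR := (H.rank_bounds hL).1 x (f.le.trans_lt ha) hhead
      have key : ∀ {c : P} (hc : c < x) (k : EntHom c y) {R : List ((P × P) × Bool)},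
          Refines L R → exponentSum (x, a) (FreeGroup.mk (seqWord k.seq ++ R)) = 1 := by
        intro c hc k R hLR
        refine exponentSum_mk_eq_one fun l hl hla => ?_
        have hl1 : l.1.1 = x := by rw [hla]
        rcases List.mem_append.1 hl with hl | hl
        · exact ((fst_fst_le_of_mem_seqWord hl).trans_lt hc).ne hl1
        · exact (hR _ hLR l hl).ne (by rw [hl1])
      have h' := congrArg (exponentSum (x, a)) h
      rw [mk_cons_true, mk_cons_true, map_mul, map_mul, key ha f h₁, key hb g h₂] at h'
      simp [exponentSum, Ne.symm hab] at h'

/-! ### Refinements as families of entrance paths -/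

/-- A choice, for each letter `(x > y)` of a word, of an entrance path from `x` to `y`. -/
abbrev PathFamily (L : List ((P × P) × Bool)) : Type u :=
  ∀ i : Fin L.length, EntHom (L.get i).1.1 (L.get i).1.2

/-- The refinement of a word by a family of entrance paths. -/
def refineWord : ∀ (L : List ((P × P) × Bool)), PathFamily L → List ((P × P) × Bool)
  | [], _ => []
  | (_, true) :: L, C => seqWord (C 0).seq ++ refineWord L fun i => C i.succ
  | (e, false) :: L, C => (e, false) :: refineWord L fun i => C i.succ

theorem refines_refineWord (L : List ((P × P) × Bool)) (C : PathFamily L) :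
    Refines L (refineWord L C) := by
  induction L with
  | nil => exact .nil
  | cons l L ih =>
    obtain ⟨e, b⟩ := l
    cases b with
    | true => exact .pos _ (ih _)
    | false => exact .neg _ (ih _)

theorem refineWord_pair {L : List ((P × P) × Bool)} (h : ∀ i, (L.get i).1.2 < (L.get i).1.1) :
    refineWord L (fun i => EntHom.pair (h i)) = L := by
  induction L with
  | nil => rfl
  | cons l L ih =>
    obtain ⟨e, b⟩ := l
    have := ih (fun i => h i.succ)
    cases b with
    | true => exact congrArg (_ :: ·) this
    | false => exact congrArg (_ :: ·) this

theorem refineWord_mono {L : List ((P × P) × Bool)} {C D : PathFamily L} (h : C ≤ D) :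
    Refines (refineWord L C) (refineWord L D) := by
  induction L with
  | nil => exact .nil
  | cons l L ih =>
    obtain ⟨e, b⟩ := l
    have := ih (C := fun i => C i.succ) (D := fun i => D i.succ) (fun i => h i.succ)
    cases b with
    | true => exact (Refines.seqWord (h 0)).append this
    | false => exact .neg _ this

theorem exists_of_refines_refineWord {L : List ((P × P) × Bool)} {C : PathFamily L}
    {K : List ((P × P) × Bool)} (h : Refines (refineWord L C) K) :
    ∃ D, C ≤ D ∧ K = refineWord L D := by
  induction L generalizing K with
  | nil => cases h; exact ⟨C, le_rfl, rfl⟩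
  | cons l L ih =>
    obtain ⟨e, b⟩ := l
    cases b with
    | true =>
      obtain ⟨A, B, hA, hB, rfl⟩ := Refines.exists_of_append h
      obtain ⟨g, hg, rfl⟩ := hA.exists_of_seqWord
      obtain ⟨D, hD, rfl⟩ := ih hB
      exact ⟨Fin.cons g D, Fin.cases hg hD, rfl⟩
    | false =>
      cases h with
      | neg _ h =>
        obtain ⟨D, hD, rfl⟩ := ih h
        exact ⟨Fin.cons (C 0) D, Fin.cases le_rfl hD, rfl⟩

/-- Distinct families of entrance paths refine a reduced path word to distinct morphisms. -/
theorem Eval.refineWord_injective {x z : P} {L : List ((P × P) × Bool)} {γ : M.obj x ⟶ M.obj z}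
    (H : Eval x z L γ) (hL : FreeGroup.IsReduced L) {C D : PathFamily L}
    (h : FreeGroup.mk (refineWord L C) = FreeGroup.mk (refineWord L D)) : C = D := by
  induction H with
  | nil x => exact funext fun i => i.elim0
  | pos h' H ih =>
    obtain ⟨h1, h2⟩ := H.eq_of_mk_seqWord_append hL.tail (refines_refineWord _ _)
      (refines_refineWord _ _) h
    have h3 := ih hL.tail h2
    exact funext (Fin.cases h1 (congrFun h3))
  | neg h' H ih =>
    rw [refineWord, refineWord, mk_cons_false, mk_cons_false] at h
    have h3 := ih hL.tail (mul_left_cancel h)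
    refine funext (Fin.cases ?_ (congrFun h3))
    exact ((C 0).eq_pair_of_covBy (M.covBy h')).trans ((D 0).eq_pair_of_covBy (M.covBy h')).symm

/-- The morphisms above a given one are parametrized, as a poset, by the families of entrance paths
refining its reduced path word. -/
theorem Eval.exists_parametrization {x z : P} {L : List ((P × P) × Bool)} {γ : M.obj x ⟶ M.obj z}
    (H : Eval x z L γ) (hL : FreeGroup.IsReduced L) :
    ∃ e : PathFamily L ≃ {γ' // Below γ γ'}, (∀ C D, Below (e C).1 (e D).1 ↔ C ≤ D) ∧
      (∀ C, Eval x z (refineWord L C) (e C).1) := by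
  choose ev hev using fun C => H.exists_of_refines (refines_refineWord L C)
  have hle : ∀ C D, Below (ev C) (ev D) ↔ C ≤ D := by
    intro C D
    refine ⟨fun h => ?_, fun h => ⟨_, _, hev C, hev D, refineWord_mono h⟩⟩
    obtain ⟨K, hK, hK'⟩ := h.exists_refines (hev C)
    obtain ⟨D', hD', rfl⟩ := exists_of_refines_refineWord hK
    rwa [← H.refineWord_injective hL (hK'.homGroup_eq.symm.trans (hev D).homGroup_eq)]
  refine ⟨Equiv.ofBijective (fun C => ⟨ev C, _, _, H, hev C, refines_refineWord L C⟩) ⟨?_, ?_⟩,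
    hle, hev⟩
  · intro C D h
    have h' : ev C = ev D := congrArg Subtype.val h
    exact H.refineWord_injective hL ((hev C).homGroup_eq.symm.trans (h' ▸ (hev D).homGroup_eq))
  · rintro ⟨γ', h⟩
    obtain ⟨K, hK, hK'⟩ := h.exists_refines H
    have hpair : ∀ i, (L.get i).1.2 < (L.get i).1.1 := fun i => H.lt _ (L.get_mem i)
    rw [← refineWord_pair hpair] at hK
    obtain ⟨D, -, rfl⟩ := exists_of_refines_refineWord hK
    exact ⟨D, Subtype.ext ((hev D).unique hK')⟩

theorem Below.antisymm {x z : P} {γ γ' : M.obj x ⟶ M.obj z} (h : Below γ γ') (h' : Below γ' γ) :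
    γ = γ' := by
  obtain ⟨L, H, hL⟩ := Eval.exists_isReduced γ
  obtain ⟨e, he, -⟩ := H.exists_parametrization hL
  obtain ⟨C, hC⟩ := e.surjective ⟨γ, Below.refl γ⟩
  obtain ⟨D, hD⟩ := e.surjective ⟨γ', h⟩
  have h1 : C ≤ D := (he C D).1 (by rw [hC, hD]; exact h)
  have h2 : D ≤ C := (he D C).1 (by rw [hC, hD]; exact h')
  have h3 := hC.symm.trans ((congrArg e (le_antisymm h1 h2)).trans hD)
  exact congrArg Subtype.val h3

variable (M) in
/-- The morphisms between two cells in the localization, ordered by refinement. -/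
instance homOrder (x z : P) : PartialOrder (M.obj x ⟶ M.obj z) where
  le := Below
  le_refl := Below.refl
  le_trans _ _ _ := Below.trans
  le_antisymm _ _ := Below.antisymm

/-! ### The dimension of a morphism -/

theorem wordDim_seqWord (c : P → ℤ) {x y : P} (g : EntHom x y) :
    wordDim c (seqWord g.seq) = c x - c y - (g.seq.length - 1) := by
  induction g using EntHom.pair_comp_induction with
  | id x => simp [wordDim, EntHom.id, seqWord]
  | @cons x a y h g ih =>
    rw [seqWord_pair_comp, ← List.singleton_append, wordDim_append, ih, EntHom.pair_comp_seq]
    simp [wordDim]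
    ring

theorem _root_.EntHom.eq_pair_of_length_le {x y : P} (h : y < x) (g : EntHom x y)
    (hg : g.seq.length ≤ 2) : g = EntHom.pair h :=
  (EntHom.ext ((EntHom.pair_sublist h g).eq_of_length_le hg)).symm

/-- A proper refinement of a path word lowers its dimension. -/
theorem Eval.eq_or_wordDim_lt (c : P → ℤ) {x z : P} {L L' : List ((P × P) × Bool)}
    {γ : M.obj x ⟶ M.obj z} (H : Eval x z L γ) (h : Refines L L') :
    L' = L ∨ wordDim c L' < wordDim c L := by
  induction H generalizing L' with
  | nil x => cases h; exact .inl rfl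
  | @pos x y z L γ hyx H ih =>
    cases h with
    | @pos _ _ g _ K h =>
      rw [wordDim_append, wordDim_seqWord, ← List.singleton_append, wordDim_append]
      have e1 : wordDim c [((x, y), true)] = c x - c y - 1 := by simp [wordDim]
      rw [e1]
      by_cases hg : g.seq.length ≤ 2
      · obtain rfl := g.eq_pair_of_length_le hyx hg
        rcases ih h with rfl | h
        · exact .inl rfl
        · right; simp [EntHom.pair, h]
      · right
        push Not at hg
        have : wordDim c K ≤ wordDim c L := (ih h).elim (fun h => h ▸ le_rfl) le_of_lt
        have hg' : (3 : ℤ) ≤ g.seq.length := by exact_mod_cast hg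
        linarith
  | neg hxu H ih =>
    cases h with
    | @neg _ _ K h =>
      rcases ih h with rfl | h
      · exact .inl rfl
      · right
        simp only [wordDim, List.map_cons, List.sum_cons] at h ⊢
        linarith

theorem Eval.lift_mk_eq_wordDim {c : P → ℤ} (hc : ∀ x u, M.pair x u → c x = c u + 1) {x z : P}
    {L : List ((P × P) × Bool)} {γ : M.obj x ⟶ M.obj z} (H : Eval x z L γ) :
    FreeGroup.lift (fun e : P × P => Multiplicative.ofAdd (c e.1 - c e.2 - 1)) (FreeGroup.mk L) =
      Multiplicative.ofAdd (wordDim c L) := by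
  induction H with
  | nil x => simp [wordDim]
  | pos h H ih =>
    rw [mk_cons_true, map_mul, ih, ← List.singleton_append, wordDim_append, ofAdd_add]
    simp [wordDim]
  | neg h H ih =>
    rw [mk_cons_false, map_mul, ih, ← List.singleton_append, wordDim_append, ofAdd_add]
    simp [wordDim, hc _ _ h]

/-- The dimension is well defined on morphisms when matched cells differ by one in dimension. -/
theorem Eval.wordDim_eq {c : P → ℤ} (hc : ∀ x u, M.pair x u → c x = c u + 1) {x z : P}
    {L L' : List ((P × P) × Bool)} {γ : M.obj x ⟶ M.obj z} (H : Eval x z L γ)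
    (H' : Eval x z L' γ) : wordDim c L = wordDim c L' :=
  Multiplicative.ofAdd.injective <| (H.lift_mk_eq_wordDim hc).symm.trans <|
    (congrArg _ (H.homGroup_eq.symm.trans H'.homGroup_eq)).trans (H'.lift_mk_eq_wordDim hc)

end AcyclicMatching

/-! ### Realizations of posets -/

namespace PosetRealization

open Topology

variable {P : Type u} [PartialOrder P]

@[ext]
theorem ext {t t' : PosetRealization P} (h : ∀ p, t.weight p = t'.weight p) : t = t' := by
  cases t; cases t'; congr; exact funext h

theorem isChain_support (t : PosetRealization P) : IsChain (· ≤ ·) {p | t.weight p ≠ 0} := by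
  obtain ⟨c, hc, h0, -⟩ := t.chain
  exact hc.mono fun p hp => by_contra fun h => hp (h0 p h)

theorem sum_eq_one (t : PosetRealization P) {s : Finset P} (hs : ∀ p ∉ s, t.weight p = 0) :
    ∑ p ∈ s, t.weight p = 1 := by
  classical
  obtain ⟨c, -, h0, h1⟩ := t.chain
  rw [← h1]
  refine (Finset.sum_subset (Finset.subset_union_left (s₂ := c)) ?_).trans
    (Finset.sum_subset Finset.subset_union_right ?_).symm
  · exact fun p _ hp => hs p hp
  · exact fun p _ hp => h0 p hp

/-- A point of the realization, given by weights on a finite set. -/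
def ofFinset (s : Finset P) (a : P → ℝ) (h0 : ∀ p, 0 ≤ a p) (hs : ∀ p ∉ s, a p = 0)
    (hc : IsChain (· ≤ ·) {p | a p ≠ 0}) (h1 : ∑ p ∈ s, a p = 1) : PosetRealization P where
  weight := a
  nonneg := h0
  chain := by
    classical
    refine ⟨s.filter (a · ≠ 0), hc.mono fun p hp => (Finset.mem_filter.1 hp).2, fun p hp => ?_, ?_⟩
    · by_contra h
      exact hp (Finset.mem_filter.2 ⟨by_contra fun h' => h (hs p h'), h⟩)
    · rw [Finset.sum_filter_ne_zero, h1]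

/-- The carrier of a point has a top vertex. -/
theorem exists_greatest (t : PosetRealization P) :
    ∃ y, t.weight y ≠ 0 ∧ ∀ p, t.weight p ≠ 0 → p ≤ y := by
  classical
  obtain ⟨c, hc, h0, h1⟩ := t.chain
  have hne : (c.filter (t.weight · ≠ 0)).Nonempty := by
    by_contra h
    rw [Finset.not_nonempty_iff_eq_empty] at h
    rw [← Finset.sum_filter_ne_zero, h] at h1
    simp at h1
  obtain ⟨y, hy⟩ := Finset.exists_maximal hne
  have hy1 := (Finset.mem_filter.1 hy.1).2
  refine ⟨y, hy1, fun p hp => ?_⟩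
  rcases t.isChain_support.total hp hy1 with h | h
  · exact h
  · refine hy.2 (Finset.mem_filter.2 ⟨by_contra fun h' => hp (h0 p h'), hp⟩) h

theorem continuous_weight (p : P) : Continuous fun t : PosetRealization P => t.weight p := by
  refine continuous_iSup_dom.2 fun s => continuous_coinduced_dom.2 ?_
  exact (continuous_apply p).comp (continuous_induced_dom (f := fun t : Sub s => t.1.weight))

theorem continuous_sub_val (s : Finset P) : Continuous fun t : Sub s => t.1 :=
  continuous_iff_coinduced_le.2 (le_iSup (fun s : Finset P =>
    TopologicalSpace.coinduced (fun t : Sub s => t.1) inferInstance) s)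

instance : T2Space (PosetRealization P) :=
  T2Space.of_injective_continuous (f := fun t : PosetRealization P => t.weight)
    (fun _ _ h => ext (congrFun h)) (continuous_pi continuous_weight)

theorem isClosed_iff {A : Set (PosetRealization P)} :
    IsClosed A ↔ ∀ s : Finset P, IsClosed ((fun t : Sub s => t.1) ⁻¹' A) := by
  refine isClosed_iSup_iff.trans (forall_congr' fun s => ?_)
  exact isClosed_coinduced

/-- Finite subcomplexes are compact: the coordinates form a closed subset of a cube. -/
instance (s : Finset P) : CompactSpace (Sub s) := by
  have hind : IsInducing fun t : Sub s => t.1.weight := ⟨rfl⟩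
  refine ⟨hind.isCompact_iff.2 ?_⟩
  let K : Set (P → ℝ) := {a | (∀ p, 0 ≤ a p) ∧ (∀ p, p ∉ s → a p = 0) ∧
    (∀ p q, ¬ (p ≤ q ∨ q ≤ p) → a p * a q = 0) ∧ ∑ p ∈ s, a p = 1}
  have hK : (fun t : Sub s => t.1.weight) '' Set.univ = K := by
    ext a
    constructor
    · rintro ⟨t, -, rfl⟩
      refine ⟨t.1.nonneg, t.2, fun p q hpq => ?_, t.1.sum_eq_one t.2⟩
      by_contra h
      exact hpq (t.1.isChain_support.total (left_ne_zero_of_mul h) (right_ne_zero_of_mul h))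
    · rintro ⟨h0, hs, hc, h1⟩
      refine ⟨⟨ofFinset s a h0 hs (fun p hp q hq _ => ?_) h1, hs⟩, trivial, rfl⟩
      by_contra h
      exact (mul_ne_zero hp hq) (hc p q h)
  rw [hK]
  refine (isCompact_univ_pi (fun _ : P => isCompact_Icc (a := (0 : ℝ)) (b := 1))).of_isClosed_subset
    ?_ ?_
  · simp only [K, Set.ofPred_and, Set.ofPred_forall]
    refine .inter ?_ (.inter ?_ (.inter ?_ ?_))
    · exact isClosed_iInter fun p => isClosed_le continuous_const (continuous_apply p)
    · exact isClosed_iInter fun p => isClosed_iInter fun _ =>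
        isClosed_eq (continuous_apply p) continuous_const
    · exact isClosed_iInter fun p => isClosed_iInter fun q => isClosed_iInter fun _ =>
        isClosed_eq ((continuous_apply p).mul (continuous_apply q)) continuous_const
    · exact isClosed_eq (continuous_finsetSum _ fun p _ => continuous_apply p) continuous_const
  · rintro a ⟨h0, hs, -, h1⟩ p -
    refine ⟨h0 p, ?_⟩
    by_cases hp : p ∈ s
    · rw [← h1]
      exact Finset.single_le_sum (fun p _ => h0 p) hp
    · rw [hs p hp]
      exact zero_le_one

theorem compactSpace_of_finite [Finite P] : CompactSpace (PosetRealization P) := by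
  have := Fintype.ofFinite P
  refine ⟨?_⟩
  have hsurj : Function.Surjective fun t : Sub (Finset.univ : Finset P) => t.1 :=
    fun t => ⟨⟨t, by simp⟩, rfl⟩
  rw [← hsurj.range_eq]
  exact isCompact_range (continuous_sub_val _)

/-- The closed cell of `x`: the realization of the poset of elements below `x`. -/
def cone (x : P) : Set (PosetRealization P) := {t | ∀ p, ¬ p ≤ x → t.weight p = 0}

theorem compactSpace_cone {x : P} (hx : (Set.Iic x).Finite) : CompactSpace (cone x) := by
  rw [← isCompact_iff_compactSpace]
  have : cone x = Set.range fun t : Sub hx.toFinset => t.1 := by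
    ext t
    constructor
    · exact fun ht => ⟨⟨t, fun p hp => ht p (by simpa using hp)⟩, rfl⟩
    · rintro ⟨t, rfl⟩ p hp
      exact t.2 p (by simpa using hp)
  rw [this]
  exact isCompact_range (continuous_sub_val _)

end PosetRealization

open PosetRealization

/-! ### Chain fans -/

/-- Vectors `v q` indexed by a finite poset whose chains span the cones of a complete simplicial
fan: every point is a unique nonnegative combination of vectors indexed by a chain. -/
def IsChainFan {Q : Type*} [Fintype Q] [PartialOrder Q] {E : Type*} [AddCommGroup E] [Module ℝ E]
    (v : Q → E) : Prop :=
  ∀ p, ∃! a : Q → ℝ, (∀ q, 0 ≤ a q) ∧ IsChain (· ≤ ·) {q | a q ≠ 0} ∧ ∑ q, a q • v q = p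

namespace IsChainFan

section Algebra

variable {Q : Type*} [Fintype Q] [PartialOrder Q] {E : Type*} [AddCommGroup E] [Module ℝ E]
  {v : Q → E}

theorem linearEquiv (hv : IsChainFan v) {F : Type*} [AddCommGroup F] [Module ℝ F] (L : E ≃ₗ[ℝ] F) :
    IsChainFan fun q => L (v q) := by
  intro p
  have key : ∀ a : Q → ℝ, ∑ q, a q • L (v q) = p ↔ ∑ q, a q • v q = L.symm p := by
    intro a
    rw [LinearEquiv.eq_symm_apply, map_sum]
    simp
  simp only [key]
  exact hv _

theorem comp_equiv (hv : IsChainFan v) {Q' : Type*} [Fintype Q'] [PartialOrder Q'] (e : Q' ≃ Q)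
    (he : ∀ a b, e a ≤ e b ∨ e b ≤ e a ↔ a ≤ b ∨ b ≤ a) : IsChainFan fun q => v (e q) := by
  intro p
  have key : ∀ a : Q' → ℝ, (((∀ q, 0 ≤ a q) ∧ IsChain (· ≤ ·) {q | a q ≠ 0} ∧
      ∑ q, a q • v (e q) = p) ↔ (∀ q, 0 ≤ a (e.symm q)) ∧
      IsChain (· ≤ ·) {q | a (e.symm q) ≠ 0} ∧ ∑ q, a (e.symm q) • v q = p) := by
    intro a
    refine and_congr ?_ (and_congr ?_ ?_)
    · exact ⟨fun h q => h _, fun h q => by simpa using h (e q)⟩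
    · constructor
      · intro h q hq q' hq' hne
        have := h hq hq' (by simpa using hne)
        simpa using (he _ _).2 this
      · intro h q hq q' hq' hne
        exact (he _ _).1 <| h (by simpa using hq) (by simpa using hq') (by simpa using hne)
    · rw [← e.sum_comp]
      simp
  obtain ⟨a, ha, hau⟩ := hv p
  refine ⟨fun q => a (e q), (key _).2 (by simpa using ha), fun b hb => ?_⟩
  have := hau _ ((key b).1 hb)
  funext q
  simpa using congrFun this (e q)

theorem eq_smul (hv : IsChainFan v) {a b : Q → ℝ} (ha : ∀ q, 0 ≤ a q)
    (hac : IsChain (· ≤ ·) {q | a q ≠ 0}) (hb : ∀ q, 0 ≤ b q)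
    (hbc : IsChain (· ≤ ·) {q | b q ≠ 0}) {c : ℝ} (hc : 0 ≤ c)
    (h : ∑ q, a q • v q = c • ∑ q, b q • v q) (q : Q) : a q = c * b q := by
  have := (hv (∑ q, a q • v q)).unique ⟨ha, hac, rfl⟩ (y₂ := fun q => c * b q)
    ⟨fun q => mul_nonneg hc (hb q), hbc.mono fun q hq => right_ne_zero_of_mul hq, by
      rw [h, Finset.smul_sum]; simp [mul_smul]⟩
  exact congrFun this q

theorem eq_zero (hv : IsChainFan v) {a : Q → ℝ} (ha : ∀ q, 0 ≤ a q)
    (hac : IsChain (· ≤ ·) {q | a q ≠ 0}) (h : ∑ q, a q • v q = 0) (q : Q) : a q = 0 := by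
  simpa using hv.eq_smul ha hac ha hac le_rfl (by simpa using h) q

end Algebra

variable {Q : Type u} [Fintype Q] [PartialOrder Q] {E : Type*} [NormedAddCommGroup E]
  [NormedSpace ℝ E] {v : Q → E}

/-- The realization of a poset carrying a chain fan is a sphere, by radial projection. -/
theorem nonempty_homeomorph_sphere (hv : IsChainFan v) :
    Nonempty (PosetRealization Q ≃ₜ Metric.sphere (0 : E) 1) := by
  have := compactSpace_of_finite (P := Q)
  let φ : PosetRealization Q → E := fun t => ∑ q, t.weight q • v q
  have hφ : Continuous φ :=
    continuous_finsetSum _ fun q _ => (continuous_weight q).smul continuous_const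
  have hsum : ∀ t : PosetRealization Q, ∑ q, t.weight q = 1 := fun t => t.sum_eq_one (by simp)
  have hφ0 : ∀ t, φ t ≠ 0 := by
    intro t h
    have h1 := hsum t
    simp [hv.eq_zero t.nonneg t.isChain_support h] at h1
  let ψ : PosetRealization Q → Metric.sphere (0 : E) 1 := fun t =>
    ⟨‖φ t‖⁻¹ • φ t, by simp [norm_smul, hφ0 t]⟩
  have hψ : Continuous ψ :=
    ((hφ.norm.inv₀ fun t => norm_ne_zero_iff.2 (hφ0 t)).smul hφ).subtype_mk _
  have hbij : Function.Bijective ψ := by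
    constructor
    · intro t t' h
      have h1 : ‖φ t‖⁻¹ • φ t = ‖φ t'‖⁻¹ • φ t' := congrArg Subtype.val h
      have h2 : φ t = (‖φ t‖ * ‖φ t'‖⁻¹) • φ t' := by
        rw [mul_smul, ← h1, smul_smul, mul_inv_cancel₀ (norm_ne_zero_iff.2 (hφ0 t)), one_smul]
      have h3 := hv.eq_smul t.nonneg t.isChain_support t'.nonneg t'.isChain_support
        (by positivity) h2
      have h4 : ‖φ t‖ * ‖φ t'‖⁻¹ = 1 := by
        have := hsum t
        simpa only [h3, ← Finset.mul_sum, hsum t', mul_one] using this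
      exact PosetRealization.ext fun q => by rw [h3, h4, one_mul]
    · rintro ⟨p, hp⟩
      obtain ⟨a, ⟨ha0, hac, hap⟩, -⟩ := hv p
      have hp1 : ‖p‖ = 1 := by simpa using hp
      have hA : 0 < ∑ q, a q := by
        refine lt_of_le_of_ne (Finset.sum_nonneg fun q _ => ha0 q) fun h => ?_
        have h0 := (Finset.sum_eq_zero_iff_of_nonneg fun q _ => ha0 q).1 h.symm
        have : p = 0 := by rw [← hap]; exact Finset.sum_eq_zero fun q hq => by rw [h0 q hq, zero_smul]
        simp [this] at hp1
      let t : PosetRealization Q := ofFinset Finset.univ (fun q => (∑ q, a q)⁻¹ * a q)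
        (fun q => mul_nonneg (inv_nonneg.2 hA.le) (ha0 q)) (by simp)
        (hac.mono fun q hq => right_ne_zero_of_mul hq)
        (by rw [← Finset.mul_sum, inv_mul_cancel₀ hA.ne'])
      have ht : φ t = (∑ q, a q)⁻¹ • p := by
        simp only [φ, t, ofFinset, mul_smul, ← Finset.smul_sum, hap]
      refine ⟨t, Subtype.ext ?_⟩
      change ‖φ t‖⁻¹ • φ t = p
      rw [ht, norm_smul, hp1, Real.norm_of_nonneg (inv_nonneg.2 hA.le), mul_one, inv_inv, smul_smul,
        mul_inv_cancel₀ hA.ne', one_smul]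
  exact ⟨Continuous.homeoOfEquivCompactToT2 (f := Equiv.ofBijective ψ hbij) hψ⟩

/-- If the elements strictly below `x` carry a chain fan, then the realization of the elements below
`x` is a ball with `x` at its centre; the norm of a point is its total weight off `x`. -/
theorem exists_homeomorph_closedBall {P : Type u} [PartialOrder P] {x : P}
    (hx : (Set.Iic x).Finite) [Fintype {y // y < x}] {v : {y // y < x} → E} (hv : IsChainFan v) :
    ∃ h : cone x ≃ₜ Metric.closedBall (0 : E) 1, ∀ t, ‖(h t).1‖ = 1 - t.1.weight x := by
  classical
  have := compactSpace_cone hx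
  let φ : cone x → E := fun t => ∑ q, t.1.weight q.1 • v q
  have hw : ∀ p, Continuous fun t : cone x => t.1.weight p := fun p =>
    (continuous_weight p).comp continuous_subtype_val
  have hφ : Continuous φ := continuous_finsetSum _ fun q _ => (hw _).smul continuous_const
  have hset : hx.toFinset = insert x (Finset.univ.map (Function.Embedding.subtype (· < x))) := by
    ext y; simp [le_iff_lt_or_eq, or_comm]
  have hsumx : ∀ a : P → ℝ, ∑ p ∈ hx.toFinset, a p = a x + ∑ q : {y // y < x}, a q.1 := by
    intro a
    rw [hset, Finset.sum_insert (by simp), Finset.sum_map]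
    rfl
  have hsum : ∀ t : cone x, ∑ q : {y // y < x}, t.1.weight q.1 = 1 - t.1.weight x := by
    intro t
    have := t.1.sum_eq_one (s := hx.toFinset) fun p hp => t.2 p (by simpa using hp)
    rw [hsumx] at this
    linarith
  have hchain : ∀ t : cone x, IsChain (· ≤ ·) {q : {y // y < x} | t.1.weight q.1 ≠ 0} :=
    fun t q hq q' hq' hne => t.1.isChain_support hq hq' (fun h => hne (Subtype.ext h))
  have hφ0 : ∀ t, φ t = 0 → ∀ q : {y // y < x}, t.1.weight q.1 = 0 := fun t h =>
    hv.eq_zero (fun q => t.1.nonneg q.1) (hchain t) h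
  have hle : ∀ t : cone x, 0 ≤ 1 - t.1.weight x := fun t =>
    (hsum t) ▸ Finset.sum_nonneg fun q _ => t.1.nonneg q.1
  let χ : cone x → E := fun t => ((1 - t.1.weight x) * ‖φ t‖⁻¹) • φ t
  have hnorm : ∀ t, ‖χ t‖ = 1 - t.1.weight x := by
    intro t
    by_cases h : φ t = 0
    · have h1 := hsum t
      simp only [hφ0 t h, Finset.sum_const_zero] at h1
      simp [χ, h, ← h1]
    · rw [norm_smul, norm_mul, norm_inv, norm_norm, Real.norm_of_nonneg (hle t), mul_assoc,
        inv_mul_cancel₀ (norm_ne_zero_iff.2 h), mul_one]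
  have hχ : Continuous χ := by
    rw [continuous_iff_continuousAt]
    intro t
    by_cases h : φ t = 0
    · have h0 : χ t = 0 := by simp [χ, h]
      rw [ContinuousAt, h0, tendsto_zero_iff_norm_tendsto_zero]
      have h1 : Continuous fun t => ‖χ t‖ := by
        simp only [hnorm]
        exact continuous_const.sub (hw x)
      simpa [h0] using h1.tendsto t
    · exact ((continuous_const.sub (hw x)).continuousAt.mul
        (hφ.norm.continuousAt.inv₀ (norm_ne_zero_iff.2 h))).smul hφ.continuousAt
  let ψ : cone x → Metric.closedBall (0 : E) 1 := fun t =>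
    ⟨χ t, by rw [mem_closedBall_zero_iff, hnorm]; linarith [t.1.nonneg x]⟩
  have hψ : Continuous ψ := hχ.subtype_mk _
  have hext : ∀ t t' : cone x, t.1.weight x = t'.1.weight x →
      (∀ q : {y // y < x}, t.1.weight q.1 = t'.1.weight q.1) → t = t' := by
    intro t t' h1 h2
    refine Subtype.ext (PosetRealization.ext fun p => ?_)
    by_cases hp : p ≤ x
    · rcases hp.eq_or_lt with rfl | hp
      · exact h1
      · exact h2 ⟨p, hp⟩
    · rw [t.2 p hp, t'.2 p hp]
  have hbij : Function.Bijective ψ := by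
    constructor
    · intro t t' h
      have h1 : χ t = χ t' := congrArg Subtype.val h
      have hxx : t.1.weight x = t'.1.weight x := by
        have := hnorm t
        rw [h1, hnorm] at this
        linarith
      refine hext t t' hxx ?_
      by_cases hr : 1 - t.1.weight x = 0
      · intro q
        have h2 := (Finset.sum_eq_zero_iff_of_nonneg fun q _ => t.1.nonneg q.1).1
          ((hsum t).trans hr) q (Finset.mem_univ _)
        have h3 := (Finset.sum_eq_zero_iff_of_nonneg fun q _ => t'.1.nonneg q.1).1
          ((hsum t').trans (hxx ▸ hr)) q (Finset.mem_univ _)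
        rw [h2, h3]
      · have hne : φ t ≠ 0 := fun h => hr (by rw [← hnorm]; simp [χ, h])
        have h2 : φ t = (‖φ t‖ * ‖φ t'‖⁻¹) • φ t' := by
          have h3 : (1 - t.1.weight x) • (‖φ t‖⁻¹ • φ t) =
              (1 - t.1.weight x) • (‖φ t'‖⁻¹ • φ t') := by
            simpa only [χ, mul_smul, ← hxx] using h1
          have h4 := smul_right_injective E hr h3
          rw [mul_smul, ← h4, smul_smul, mul_inv_cancel₀ (norm_ne_zero_iff.2 hne), one_smul]
        have h3 := hv.eq_smul (fun q => t.1.nonneg q.1) (hchain t) (fun q => t'.1.nonneg q.1)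
          (hchain t') (by positivity) h2
        have h4 : ‖φ t‖ * ‖φ t'‖⁻¹ = 1 := by
          have := hsum t
          simp only [h3, ← Finset.mul_sum, hsum t', ← hxx] at this
          exact mul_right_cancel₀ hr (this.trans (one_mul _).symm)
        exact fun q => by rw [h3, h4, one_mul]
    · rintro ⟨p, hp⟩
      rw [mem_closedBall_zero_iff] at hp
      obtain ⟨a, ⟨ha0, hac, hap⟩, -⟩ := hv p
      -- For `p = 0` all coefficients vanish, and the junk value `0⁻¹ = 0` does no harm.
      let A := ∑ q, a q
      let b : P → ℝ := fun y => if h : y < x then ‖p‖ * A⁻¹ * a ⟨y, h⟩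
        else if y = x then 1 - ‖p‖ else 0
      have hbx : b x = 1 - ‖p‖ := by simp [b]
      have hbq : ∀ q : {y // y < x}, b q.1 = ‖p‖ * A⁻¹ * a q := fun q => by simp [b, q.2]
      have hA0 : 0 ≤ A := Finset.sum_nonneg fun q _ => ha0 q
      have hpA : A = 0 → p = 0 := by
        intro h
        have h0 := (Finset.sum_eq_zero_iff_of_nonneg fun q _ => ha0 q).1 h
        rw [← hap]
        exact Finset.sum_eq_zero fun q hq => by rw [h0 q hq, zero_smul]
      have hbsum : ∑ q : {y // y < x}, b q.1 = ‖p‖ := by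
        simp only [hbq, ← Finset.mul_sum]
        change ‖p‖ * A⁻¹ * A = ‖p‖
        by_cases h : A = 0
        · simp [hpA h]
        · rw [mul_assoc, inv_mul_cancel₀ h, mul_one]
      have hb0 : ∀ y, 0 ≤ b y := by
        intro y
        simp only [b]
        split_ifs
        · exact mul_nonneg (mul_nonneg (norm_nonneg _) (inv_nonneg.2 hA0)) (ha0 _)
        · linarith
        · exact le_rfl
      have hbs : ∀ y, ¬ y ≤ x → b y = 0 := fun y hy => by
        have h1 : ¬ y < x := fun h => hy h.le
        have h2 : y ≠ x := fun h => hy h.le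
        simp [b, h1, h2]
      have hbc : IsChain (· ≤ ·) {y | b y ≠ 0} := by
        intro y hy y' hy' hne
        have h1 : y ≤ x := by_contra fun h => hy (hbs y h)
        have h2 : y' ≤ x := by_contra fun h => hy' (hbs y' h)
        rcases h1.eq_or_lt with rfl | h1
        · exact .inr h2
        rcases h2.eq_or_lt with rfl | h2
        · exact .inl h1.le
        have h3 : a ⟨y, h1⟩ ≠ 0 := fun h => hy (by rw [hbq ⟨y, h1⟩, h, mul_zero])
        have h4 : a ⟨y', h2⟩ ≠ 0 := fun h => hy' (by rw [hbq ⟨y', h2⟩, h, mul_zero])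
        exact hac h3 h4 fun h => hne (congrArg Subtype.val h)
      let t : cone x := ⟨ofFinset hx.toFinset b hb0 (by simpa using hbs) hbc
        (by rw [hsumx, hbx, hbsum]; ring), hbs⟩
      have ht : φ t = (‖p‖ * A⁻¹) • p := by
        simp only [φ, t, ofFinset, hbq, mul_smul, ← Finset.smul_sum, hap]
      refine ⟨t, Subtype.ext ?_⟩
      change ((1 - b x) * ‖φ t‖⁻¹) • φ t = p
      rw [hbx, ht, norm_smul]
      by_cases h : p = 0
      · simp [h]
      · have hA : A ≠ 0 := fun h' => h (hpA h')
        have hp0 : ‖p‖ ≠ 0 := norm_ne_zero_iff.2 h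
        rw [Real.norm_of_nonneg (mul_nonneg (norm_nonneg _) (inv_nonneg.2 hA0)), smul_smul]
        have : (1 - (1 - ‖p‖)) * (‖p‖ * A⁻¹ * ‖p‖)⁻¹ * (‖p‖ * A⁻¹) = 1 := by
          field_simp
          ring
        rw [this, one_smul]
  exact ⟨Continuous.homeoOfEquivCompactToT2 (f := Equiv.ofBijective ψ hbij) hψ, hnorm⟩

end IsChainFan

/-! ### Regular CW complexes from chain fans -/

section RegularCW

open Metric Topology

variable {P : Type u} [PartialOrder P]

namespace PosetRealization

/-- The point of the realization at a vertex. -/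
noncomputable def vertex (x : P) : PosetRealization P := by
  classical
  exact ofFinset {x} (fun p => if p = x then 1 else 0) (fun p => by split_ifs <;> norm_num)
    (fun p hp => by simpa using hp) (by
      have : {p | (if p = x then (1 : ℝ) else 0) ≠ 0} = {x} := by ext p; simp
      rw [this]; exact IsChain.singleton) (by simp)

theorem vertex_weight_self (x : P) : (vertex x).weight x = 1 := by simp [vertex, ofFinset]

theorem vertex_weight_of_ne {x y : P} (h : y ≠ x) : (vertex x).weight y = 0 := by
  simp [vertex, ofFinset, h]

theorem vertex_mem_cone (x : P) : vertex x ∈ cone x := fun _ hp =>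
  vertex_weight_of_ne fun h => hp h.le

theorem cone_subset_cone {x y : P} : cone x ⊆ cone y ↔ x ≤ y := by
  constructor
  · intro h
    by_contra hxy
    have := h (vertex_mem_cone x) x hxy
    rw [vertex_weight_self] at this
    exact one_ne_zero this
  · exact fun h t ht p hp => ht p fun h' => hp (h'.trans h)

/-- The weak topology is already determined by the closed cells. -/
theorem isClosed_of_inter_cone {A : Set (PosetRealization P)}
    (h : ∀ x, IsClosed (A ∩ cone x)) : IsClosed A := by
  refine isClosed_iff.2 fun s => ?_
  have : (fun t : Sub s => t.1) ⁻¹' A = ⋃ x ∈ s, (fun t : Sub s => t.1) ⁻¹' (A ∩ cone x) := by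
    ext t
    simp only [Set.mem_preimage, Set.mem_iUnion, Set.mem_inter_iff]
    constructor
    · intro ht
      obtain ⟨y, hy, hmax⟩ := t.1.exists_greatest
      exact ⟨y, by_contra fun h => hy (t.2 y h), ht, fun p hp => by_contra fun h => hp (hmax p h)⟩
    · rintro ⟨x, -, h, -⟩
      exact h
  rw [this]
  exact s.finite_toSet.isClosed_biUnion fun x _ => (h x).preimage (continuous_sub_val s)

variable {n : ℕ} {x : P} (h : cone x ≃ₜ closedBall (0 : Fin n → ℝ) 1)
  (hh : ∀ t, ‖(h t).1‖ = 1 - t.1.weight x)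

open Classical in
/-- The characteristic map of the cell `x`, given a homeomorphism of the closed cell with a ball. -/
noncomputable def charMap : PartialEquiv (Fin n → ℝ) (PosetRealization P) where
  toFun p := if hp : p ∈ closedBall 0 1 then (h.symm ⟨p, hp⟩).1 else vertex x
  invFun t := if ht : t ∈ cone x then (h ⟨t, ht⟩).1 else 0
  source := ball 0 1
  target := {t | t ∈ cone x ∧ t.weight x ≠ 0}
  map_source' p hp := by
    have hp' := ball_subset_closedBall hp
    rw [dif_pos hp']
    refine ⟨(h.symm ⟨p, hp'⟩).2, fun h0 => ?_⟩
    have := hh (h.symm ⟨p, hp'⟩)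
    rw [h.apply_symm_apply, h0] at this
    rw [mem_ball_zero_iff, this] at hp
    linarith
  map_target' t ht := by
    rw [dif_pos ht.1, mem_ball_zero_iff, hh]
    have := lt_of_le_of_ne (t.nonneg x) (Ne.symm ht.2)
    simpa using this
  left_inv' p hp := by
    have hp' := ball_subset_closedBall hp
    simp only [dif_pos hp', (h.symm ⟨p, hp'⟩).2, dite_true]
    simp
  right_inv' t ht := by
    rw [dif_pos ht.1, dif_pos (h ⟨t, ht.1⟩).2]
    simp

theorem charMap_of_mem {p : Fin n → ℝ} (hp : p ∈ closedBall 0 1) :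
    charMap h hh p = (h.symm ⟨p, hp⟩).1 := dif_pos hp

theorem charMap_image_closedBall : charMap h hh '' closedBall 0 1 = cone x := by
  ext t
  constructor
  · rintro ⟨p, hp, rfl⟩
    rw [charMap_of_mem h hh hp]
    exact Subtype.prop _
  · intro ht
    refine ⟨(h ⟨t, ht⟩).1, (h ⟨t, ht⟩).2, ?_⟩
    rw [charMap_of_mem h hh (h ⟨t, ht⟩).2]
    simp

theorem charMap_continuousOn : ContinuousOn (charMap h hh) (closedBall 0 1) := by
  rw [continuousOn_iff_continuous_domRestrict]
  have : (closedBall 0 1).domRestrict (charMap h hh) = fun p => (h.symm p).1 :=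
    funext fun p => charMap_of_mem h hh p.2
  rw [this]
  exact continuous_subtype_val.comp h.symm.continuous

theorem charMap_symm_continuousOn : ContinuousOn (charMap h hh).symm (charMap h hh).target := by
  have : ContinuousOn (charMap h hh).symm (cone x) := by
    rw [continuousOn_iff_continuous_domRestrict]
    have : (cone x).domRestrict (charMap h hh).symm = fun t => (h t).1 :=
      funext fun t => dif_pos t.2
    rw [this]
    exact continuous_subtype_val.comp h.continuous
  exact this.mono fun t ht => ht.1

theorem charMap_injOn : Set.InjOn (charMap h hh) (closedBall 0 1) := by
  intro p hp q hq hpq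
  rw [charMap_of_mem h hh hp, charMap_of_mem h hh hq] at hpq
  exact congrArg Subtype.val (h.symm.injective (Subtype.ext hpq))

end PosetRealization

/-- A poset in which the elements strictly below each `x` carry a chain fan in a Euclidean space of
dimension `dim x` is the face poset of a regular CW complex, namely of its realization. -/
theorem isRegularCWFacePoset_of_isChainFan (dim : P → ℕ) (hdim : StrictMono dim)
    (hfin : ∀ x : P, (Set.Iic x).Finite)
    (hfan : ∀ (x : P) [Fintype {y // y < x}], ∃ v : {y // y < x} → (Fin (dim x) → ℝ),
      IsChainFan v) :
    IsRegularCWFacePoset P := by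
  classical
  have key : ∀ (n : ℕ) (c : {x : P // dim x = n}),
      ∃ h : cone c.1 ≃ₜ closedBall (0 : Fin n → ℝ) 1, ∀ t, ‖(h t).1‖ = 1 - t.1.weight c.1 := by
    rintro n ⟨x, rfl⟩
    have : Finite {y // y < x} := ((hfin x).subset Set.Iio_subset_Iic_self).to_subtype
    have := Fintype.ofFinite {y // y < x}
    obtain ⟨v, hv⟩ := hfan x
    exact hv.exists_homeomorph_closedBall (hfin x)
  choose h hh using key
  let inst : CWComplex (Set.univ : Set (PosetRealization P)) :=
    { cell := fun n => {x : P // dim x = n}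
      map := fun n c => charMap (h n c) (hh n c)
      source_eq := fun n c => rfl
      continuousOn := fun n c => charMap_continuousOn _ _
      continuousOn_symm := fun n c => charMap_symm_continuousOn _ _
      pairwiseDisjoint' := by
        rintro ⟨n, x, rfl⟩ - ⟨m, y, rfl⟩ - hne
        refine Set.disjoint_left.2 ?_
        rintro _ ⟨p, hp, rfl⟩ ⟨q, hq, hpq⟩
        have h1 := (charMap (h _ ⟨x, rfl⟩) (hh _ ⟨x, rfl⟩)).map_source hp
        have h2 := (charMap (h _ ⟨y, rfl⟩) (hh _ ⟨y, rfl⟩)).map_source hq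
        simp only at hpq
        rw [hpq] at h2
        have h3 : x ≤ y := by_contra fun h => h1.2 (h2.1 x h)
        have h4 : y ≤ x := by_contra fun h => h2.2 (h1.1 y h)
        obtain rfl := le_antisymm h3 h4
        exact hne rfl
      mapsTo' := by
        rintro n ⟨x, rfl⟩
        have hf : ∀ m, {c : {y : P // dim y = m} | c.1 < x}.Finite := fun m =>
          ((hfin x).subset Set.Iio_subset_Iic_self).preimage Subtype.val_injective.injOn
        refine ⟨fun m => (hf m).toFinset, fun p hp => ?_⟩
        have hp' := sphere_subset_closedBall hp
        rw [charMap_of_mem _ _ hp']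
        set t := (h _ ⟨x, rfl⟩).symm ⟨p, hp'⟩ with ht
        have h0 : t.1.weight x = 0 := by
          have := hh _ ⟨x, rfl⟩ t
          rw [ht, Homeomorph.apply_symm_apply, ← ht] at this
          rw [mem_sphere_zero_iff_norm] at hp
          simp only at this
          linarith
        obtain ⟨y, hy, hmax⟩ := t.1.exists_greatest
        have hyx : y < x := lt_of_le_of_ne (by_contra fun h => hy (t.2 y h))
          fun h => hy (h ▸ h0)
        simp only [Set.mem_iUnion]
        refine ⟨dim y, hdim hyx, ⟨y, rfl⟩, by simpa using hyx, ?_⟩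
        rw [charMap_image_closedBall]
        exact fun p hp => by_contra fun h => hp (hmax p h)
      closed' := by
        intro A _ hA
        refine isClosed_of_inter_cone fun x => ?_
        have := hA _ ⟨x, rfl⟩
        rwa [charMap_image_closedBall] at this
      union' := by
        refine Set.eq_univ_of_forall fun t => ?_
        obtain ⟨y, hy, hmax⟩ := t.exists_greatest
        simp only [Set.mem_iUnion]
        refine ⟨dim y, ⟨y, rfl⟩, ?_⟩
        rw [charMap_image_closedBall]
        exact fun p hp => by_contra fun h => hp (hmax p h) }
  refine ⟨PosetRealization P, inferInstance, inferInstance, inst,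
    fun n c => charMap_injOn (h n c) (hh n c),
    (Equiv.sigmaFiberEquiv dim).symm, fun a b => ?_⟩
  change _ ↔ charMap (h _ ⟨a, rfl⟩) (hh _ ⟨a, rfl⟩) '' closedBall 0 1 ⊆
    charMap (h _ ⟨b, rfl⟩) (hh _ ⟨b, rfl⟩) '' closedBall 0 1
  rw [charMap_image_closedBall, charMap_image_closedBall, cone_subset_cone]

/-- A poset in which the elements strictly below each `x` carry a chain fan becomes a CW poset when
a least element is adjoined. -/
theorem isCWPoset_withBot_of_isChainFan [Nonempty P] (dim : P → ℕ)
    (hfin : ∀ x : P, (Set.Iic x).Finite)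
    (hfan : ∀ (x : P) [Fintype {y // y < x}], ∃ v : {y // y < x} → (Fin (dim x) → ℝ),
      IsChainFan v) :
    IsCWPoset (WithBot P) := by
  classical
  refine ⟨⊥, ⟨trivial, fun _ _ => bot_le⟩, inferInstance, fun x hx => ?_⟩
  obtain ⟨x, rfl⟩ := WithBot.ne_bot_iff_exists.1 hx
  have : Finite {y // y < x} := ((hfin x).subset Set.Iio_subset_Iic_self).to_subtype
  have := Fintype.ofFinite {y // y < x}
  obtain ⟨v, hv⟩ := hfan x
  let e : {y // y < x} ≃ Set.Ioo (⊥ : WithBot P) x :=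
    Equiv.ofBijective (fun y => ⟨y.1, WithBot.bot_lt_coe _, WithBot.coe_lt_coe.2 y.2⟩) <| by
      constructor
      · intro y y' h
        exact Subtype.ext (WithBot.coe_injective (congrArg Subtype.val h))
      · rintro ⟨y, hy, hy'⟩
        obtain ⟨y, rfl⟩ := WithBot.ne_bot_iff_exists.1 hy.ne'
        exact ⟨⟨y, WithBot.coe_lt_coe.1 hy'⟩, rfl⟩
  have he : ∀ a b, e a ≤ e b ↔ a ≤ b := fun a b => WithBot.coe_le_coe
  have := Fintype.ofEquiv _ e
  have h1 := hv.comp_equiv e.symm fun a b => by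
    rw [← he, ← he, e.apply_symm_apply, e.apply_symm_apply]
  have h2 := h1.linearEquiv (EuclideanSpace.equiv (Fin (dim x)) ℝ).symm.toLinearEquiv
  exact ⟨dim x, h2.nonempty_homeomorph_sphere⟩

end RegularCW

/-! ### Entrance paths as chains -/

namespace EntHom

section General

variable {P : Type u} [PartialOrder P]

theorem pairwise {x y : P} (g : EntHom x y) : g.seq.Pairwise (· > ·) :=
  List.isChain_iff_pairwise.1 g.descending

theorem total {x y : P} (g : EntHom x y) {c d : P} (hc : c ∈ g.seq) (hd : d ∈ g.seq) :
    c ≤ d ∨ d ≤ c := by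
  induction g using pair_comp_induction with
  | id x =>
    simp only [EntHom.id, List.mem_singleton] at hc hd
    exact .inl (hc.trans hd.symm).le
  | cons h g ih =>
    rw [pair_comp_seq, List.mem_cons] at hc hd
    rcases hc with rfl | hc
    · rcases hd with rfl | hd
      · exact .inl le_rfl
      · exact .inr ((g.mem_Icc d hd).2.trans h.le)
    · rcases hd with rfl | hd
      · exact .inl ((g.mem_Icc c hc).2.trans h.le)
      · exact ih hc hd

theorem le_of_subset {x y : P} {f g : EntHom x y} (h : ∀ c ∈ f.seq, c ∈ g.seq) : f ≤ g :=
  List.sublist_of_subperm_of_pairwise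
    (List.subperm_of_subset (f.pairwise.imp fun h => h.ne') h) f.pairwise g.pairwise

/-- Every finite chain with least element `y` and greatest element `x` is the set of terms of an
entrance path. -/
theorem exists_of_isChain {x y : P} (s : Finset P) (hs : IsChain (· ≤ ·) (s : Set P)) (hx : x ∈ s)
    (hy : y ∈ s) (h : ∀ c ∈ s, y ≤ c ∧ c ≤ x) : ∃ g : EntHom x y, ∀ c, c ∈ g.seq ↔ c ∈ s := by
  classical
  induction hn : s.card generalizing s x with
  | zero => rw [Finset.card_eq_zero.1 hn] at hx; simp at hx
  | succ n ih =>
    by_cases hxy : x = y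
    · subst hxy
      refine ⟨EntHom.id x, fun c => ?_⟩
      simp only [EntHom.id, List.mem_singleton]
      exact ⟨fun hc => hc ▸ hx, fun hc => le_antisymm (h c hc).2 (h c hc).1⟩
    · have hy' : y ∈ s.erase x := Finset.mem_erase.2 ⟨Ne.symm hxy, hy⟩
      obtain ⟨a, ha⟩ := Finset.exists_maximal ⟨y, hy'⟩
      have hax := Finset.mem_erase.1 ha.1
      obtain ⟨g, hg⟩ := ih (s.erase x) (hs.mono (Finset.erase_subset _ _)) ha.1 hy' (fun c hc => by
        refine ⟨(h c (Finset.mem_of_mem_erase hc)).1, ?_⟩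
        rcases hs.total (Finset.mem_of_mem_erase hc) hax.2 with h' | h'
        · exact h'
        · exact ha.2 hc h') (by rw [Finset.card_erase_of_mem hx, hn]; rfl)
      refine ⟨(pair (lt_of_le_of_ne (h a hax.2).2 hax.1)).comp g, fun c => ?_⟩
      rw [pair_comp_seq, List.mem_cons, hg, Finset.mem_erase]
      constructor
      · rintro (rfl | hc)
        · exact hx
        · exact hc.2
      · exact fun hc => or_iff_not_imp_left.2 fun hne => ⟨hne, hc⟩

theorem finite {x y : P} (h : (Set.Icc y x).Finite) : Finite (EntHom x y) := by
  have := h.to_subtype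
  refine Finite.of_injective (β := Set (Set.Icc y x)) (fun g => {c | c.1 ∈ g.seq}) fun f g hfg => ?_
  have key : ∀ c, c ∈ Set.Icc y x → (c ∈ f.seq ↔ c ∈ g.seq) := fun c hc =>
    Set.ext_iff.1 hfg ⟨c, hc⟩
  exact le_antisymm (le_of_subset fun c hc => (key c (f.mem_Icc c hc)).1 hc)
    (le_of_subset fun c hc => (key c (g.mem_Icc c hc)).2 hc)

end General

/-! ### The braid fan of an interval of simplices -/

variable {V : Type u} {X : PreAbstractSimplicialComplex V} {x y : Cell X}

/-- Some simplex of the path contains `b` but not `a`. -/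
def Separates (g : EntHom x y) (a b : V) : Prop := ∃ c ∈ g.seq, a ∉ c.1 ∧ b ∈ c.1

open Classical in
/-- The number of simplices of the path which contain `a`. -/
noncomputable def height (g : EntHom x y) (a : V) : ℕ := (g.seq.toFinset.filter (a ∈ ·.1)).card

theorem Separates.height_lt {g : EntHom x y} {a b : V} (h : g.Separates a b) :
    g.height a < g.height b := by
  classical
  obtain ⟨c, hc, ha, hb⟩ := h
  refine Finset.card_lt_card (Finset.ssubset_iff_of_subset ?_ |>.2 ⟨c, ?_, ?_⟩)
  · intro d hd
    simp only [Finset.mem_filter, List.mem_toFinset] at hd ⊢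
    refine ⟨hd.1, ?_⟩
    rcases g.total hc hd.1 with h | h
    · exact h hb
    · exact absurd (h hd.2) ha
  · simp [hc, hb]
  · simp [ha]

theorem height_le_of_not_separates {g : EntHom x y} {a b : V} (h : ¬ g.Separates a b) :
    g.height b ≤ g.height a := by
  classical
  refine Finset.card_le_card fun c hc => ?_
  simp only [Finset.mem_filter, List.mem_toFinset] at hc ⊢
  exact ⟨hc.1, by_contra fun ha => h ⟨c, hc.1, ha, hc.2⟩⟩

theorem Separates.mono {f g : EntHom x y} (hfg : f ≤ g) {a b : V} (h : f.Separates a b) :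
    g.Separates a b := by
  obtain ⟨c, hc, h⟩ := h
  exact ⟨c, (le_iff_sublist.1 hfg).subset hc, h⟩

theorem not_separates_pair (h : y < x) {a b : V} (ha : a ∈ x.1) (hb : b ∉ y.1) :
    ¬ (pair h).Separates a b := by
  rintro ⟨c, hc, h1, h2⟩
  simp only [pair, List.mem_cons, List.not_mem_nil, or_false] at hc
  rcases hc with rfl | rfl
  · exact h1 ha
  · exact hb h2

/-- Refinement of paths is detected by the separated pairs of vertices. -/
theorem le_of_separates {f g : EntHom x y}
    (h : ∀ a b, a ∈ x.1 → a ∉ y.1 → b ∈ x.1 → b ∉ y.1 → f.Separates a b → g.Separates a b) :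
    f ≤ g := by
  classical
  refine le_of_subset fun c hc => ?_
  by_contra hcg
  -- `d` is the smallest term of `g` containing `c`, and `d'` the largest one omitting a vertex `a`
  -- of `d` outside `c`; separation of `a` from the vertices of `c` forces `c ≤ d'`.
  obtain ⟨d, hd⟩ := Finset.exists_minimal (s := g.seq.toFinset.filter (c ≤ ·))
    ⟨x, by simpa [head_mem] using (f.mem_Icc c hc).2⟩
  have hd1 := hd.1
  simp only [Finset.mem_filter, List.mem_toFinset] at hd1
  have hcd : c < d := lt_of_le_of_ne hd1.2 fun h => hcg (h ▸ hd1.1)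
  obtain ⟨a, had, hac⟩ := Finset.exists_of_ssubset (show c.1 ⊂ d.1 from hcd)
  have hyc := (f.mem_Icc c hc).1
  have hay : a ∉ y.1 := fun h => hac (hyc h)
  have hax : a ∈ x.1 := (g.mem_Icc d hd1.1).2 had
  obtain ⟨d', hd'⟩ := Finset.exists_maximal (s := g.seq.toFinset.filter (a ∉ ·.1))
    ⟨y, by simpa [last_mem] using hay⟩
  have hd1' := hd'.1
  simp only [Finset.mem_filter, List.mem_toFinset] at hd1'
  have hcd' : c ≤ d' := by
    intro b hb
    by_cases hby : b ∈ y.1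
    · exact (g.mem_Icc d' hd1'.1).1 hby
    · obtain ⟨e, he, h1, h2⟩ := h a b hax hay ((f.mem_Icc c hc).2 hb) hby ⟨c, hc, hac, hb⟩
      rcases g.total he hd1'.1 with h' | h'
      · exact h' h2
      · exact hd'.2 (by simpa using ⟨he, h1⟩) h' h2
  have hdd' : d ≤ d' := by
    rcases g.total hd1.1 hd1'.1 with h' | h'
    · exact h'
    · exact hd.2 (by simpa using ⟨hd1'.1, hcd'⟩) h'
  exact hd1'.2 (hdd' had)

/-- The superlevel sets of a function on the vertices form an entrance path. -/
theorem exists_separates_iff (h : y < x) (p : V → ℝ) : ∃ g : EntHom x y,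
    ∀ a b, a ∈ x.1 → a ∉ y.1 → b ∈ x.1 → b ∉ y.1 → (g.Separates a b ↔ p a < p b) := by
  classical
  let level : ℝ → Cell X := fun r => ⟨x.1.filter fun a => a ∈ y.1 ∨ r ≤ p a, by
    refine (X.isRelLowerSet_faces x.2).2 (Finset.filter_subset _ _) ?_
    obtain ⟨a, ha⟩ := (X.isRelLowerSet_faces y.2).1
    exact ⟨a, Finset.mem_filter.2 ⟨h.le ha, .inl ha⟩⟩⟩
  have hyl : ∀ r, y ≤ level r := fun r a ha => Finset.mem_filter.2 ⟨h.le ha, .inl ha⟩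
  have hlx : ∀ r, level r ≤ x := fun r => Finset.filter_subset _ _
  have hll : ∀ r r', r ≤ r' → level r' ≤ level r := fun r r' hr a ha => by
    obtain ⟨h1, h2⟩ := Finset.mem_filter.1 ha
    exact Finset.mem_filter.2 ⟨h1, h2.imp_right hr.trans⟩
  obtain ⟨g, hg⟩ := exists_of_isChain (x := x) (y := y)
    (insert x (insert y (x.1.image fun a => level (p a)))) (by
      have h1 : IsChain (· ≤ ·) (Set.range level) := by
        rintro _ ⟨r, rfl⟩ _ ⟨r', rfl⟩ -
        exact (le_total r r').symm.imp (hll _ _) (hll _ _)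
      have h2 : IsChain (· ≤ ·) (insert x (insert y (Set.range level))) := by
        refine (h1.insert ?_).insert ?_
        · rintro _ ⟨r, rfl⟩ -
          exact .inl (hyl r)
        · rintro c (rfl | ⟨r, rfl⟩) -
          · exact .inr h.le
          · exact .inr (hlx r)
      refine h2.mono ?_
      intro c hc
      simp only [Finset.coe_insert, Finset.coe_image, Set.mem_insert_iff] at hc
      refine hc.imp_right (Or.imp_right ?_)
      rintro ⟨a, -, rfl⟩
      exact ⟨_, rfl⟩) (by simp) (by simp) (by
      intro c hc
      simp only [Finset.mem_insert, Finset.mem_image] at hc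
      rcases hc with rfl | rfl | ⟨a, -, rfl⟩
      · exact ⟨h.le, le_rfl⟩
      · exact ⟨le_rfl, h.le⟩
      · exact ⟨hyl _, hlx _⟩)
  refine ⟨g, fun a b hax hay hbx hby => ⟨?_, fun hab => ?_⟩⟩
  · rintro ⟨c, hc, hac, hbc⟩
    rw [hg] at hc
    simp only [Finset.mem_insert, Finset.mem_image] at hc
    rcases hc with rfl | rfl | ⟨e, -, rfl⟩
    · exact absurd hax hac
    · exact absurd hbc hby
    · have h1 := ((Finset.mem_filter.1 hbc).2).resolve_left hby
      have h2 : ¬ p e ≤ p a := fun h => hac (Finset.mem_filter.2 ⟨hax, .inr h⟩)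
      exact (not_le.1 h2).trans_le h1
  · refine ⟨level (p b), ?_, fun ha => ?_, Finset.mem_filter.2 ⟨hbx, .inr le_rfl⟩⟩
    · rw [hg]
      simp only [Finset.mem_insert, Finset.mem_image]
      exact .inr (.inr ⟨b, hbx, rfl⟩)
    · exact ((Finset.mem_filter.1 ha).2.resolve_left hay).not_gt hab

end EntHom

/-! ### The fan of a product of permutohedra -/

section PathFamilies

variable {V : Type u} {X : PreAbstractSimplicialComplex V} {I : Type}
  {x y : I → Cell X} (b : I → V)

/-- The coordinates: for each of the intervals `[y i, x i]`, the vertices of `x i` outside `y i`, up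
to the base vertex `b i`, at which all functions are normalized to vanish. -/
abbrev VertexIndex (x y : I → Cell X) (b : I → V) : Type u :=
  Σ i, {a : V // a ∈ (x i).1 ∧ a ∉ (y i).1 ∧ a ≠ b i}

instance [Finite I] (x y : I → Cell X) (b : I → V) : Finite (VertexIndex x y b) := by
  have : ∀ i, Finite {a : V // a ∈ (x i).1 ∧ a ∉ (y i).1 ∧ a ≠ b i} := fun i =>
    ((x i).1.finite_toSet.subset fun a ha => ha.1).to_subtype
  infer_instance

open Classical in
/-- The function on the vertices of the `i`-th interval with given normalized coordinates. -/
noncomputable def vertexFun {b : I → V} (p : VertexIndex x y b → ℝ) (i : I) (a : V) : ℝ :=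
  if h : a ∈ (x i).1 ∧ a ∉ (y i).1 ∧ a ≠ b i then p ⟨i, a, h⟩ else 0

/-- The vector of a family of entrance paths, given by the normalized height functions. -/
noncomputable def pathVector (C : ∀ i, EntHom (x i) (y i)) : VertexIndex x y b → ℝ :=
  fun j => (C j.1).height j.2.1 - (C j.1).height (b j.1)

variable {b}

theorem vertexFun_pathVector (C : ∀ i, EntHom (x i) (y i)) {i : I} {a : V} (hax : a ∈ (x i).1)
    (hay : a ∉ (y i).1) :
    vertexFun (pathVector b C) i a = (C i).height a - (C i).height (b i) := by
  by_cases h : a = b i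
  · simp [vertexFun, h]
  · simp [vertexFun, pathVector, h, hax, hay]

theorem vertexFun_sub_smul (p q : VertexIndex x y b → ℝ) (r : ℝ) (i : I) (a : V) :
    vertexFun (p - r • q) i a = vertexFun p i a - r * vertexFun q i a := by
  unfold vertexFun
  split_ifs <;> simp

theorem vertexFun_sum {κ : Type*} (s : Finset κ) (u : κ → ℝ) (q : κ → VertexIndex x y b → ℝ)
    (i : I) (a : V) :
    vertexFun (∑ k ∈ s, u k • q k) i a = ∑ k ∈ s, u k * vertexFun (q k) i a := by
  unfold vertexFun
  split_ifs <;> simp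

/-- The family of paths `C` carries the point `p`: it consists of the proper superlevel sets of
the functions with coordinates `p`. -/
def Carries (C : ∀ i, EntHom (x i) (y i)) (p : VertexIndex x y b → ℝ) : Prop :=
  ∀ i a a', a ∈ (x i).1 → a ∉ (y i).1 → a' ∈ (x i).1 → a' ∉ (y i).1 →
    ((C i).Separates a a' ↔ vertexFun p i a < vertexFun p i a')

theorem Carries.unique {C D : ∀ i, EntHom (x i) (y i)} {p : VertexIndex x y b → ℝ}
    (hC : Carries C p) (hD : Carries D p) : C = D := by
  refine funext fun i => le_antisymm (EntHom.le_of_separates ?_) (EntHom.le_of_separates ?_)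
  · exact fun a a' h1 h2 h3 h4 h => (hD i a a' h1 h2 h3 h4).2 ((hC i a a' h1 h2 h3 h4).1 h)
  · exact fun a a' h1 h2 h3 h4 h => (hC i a a' h1 h2 h3 h4).2 ((hD i a a' h1 h2 h3 h4).1 h)

theorem exists_carries (hxy : ∀ i, y i < x i) (p : VertexIndex x y b → ℝ) :
    ∃ C : ∀ i, EntHom (x i) (y i), Carries C p := by
  choose C hC using fun i => EntHom.exists_separates_iff (hxy i) (vertexFun p i)
  exact ⟨C, hC⟩

/-- A positive combination of the vectors of a chain of families is carried by the largest one. -/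
theorem carries_sum {hxy : ∀ i, y i < x i} {κ : Type*} [Fintype κ] {u : κ → ℝ} (hu : ∀ k, 0 ≤ u k)
    (D : κ → ∀ i, EntHom (x i) (y i)) {C : ∀ i, EntHom (x i) (y i)}
    (hD : ∀ k, u k ≠ 0 → D k ≤ C) (hC : C = (fun i => EntHom.pair (hxy i)) ∨ ∃ k, D k = C ∧ u k ≠ 0) :
    Carries C (∑ k, u k • pathVector b (D k)) := by
  intro i a a' hax hay hax' hay'
  have key : vertexFun (∑ k, u k • pathVector b (D k)) i a' -
      vertexFun (∑ k, u k • pathVector b (D k)) i a =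
      ∑ k, u k * ((D k i).height a' - (D k i).height a) := by
    rw [vertexFun_sum, vertexFun_sum, ← Finset.sum_sub_distrib]
    refine Finset.sum_congr rfl fun k _ => ?_
    rw [vertexFun_pathVector _ hax hay, vertexFun_pathVector _ hax' hay']
    ring
  rw [← sub_pos, key]
  constructor
  · intro h
    obtain ⟨k, rfl, hk⟩ := hC.resolve_left
      (by rintro rfl; exact EntHom.not_separates_pair (hxy i) hax hay' h)
    refine Finset.sum_pos' (fun l _ => ?_) ⟨k, Finset.mem_univ _, ?_⟩
    · by_cases hl : u l = 0
      · simp [hl]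
      · refine mul_nonneg (hu l) (sub_nonneg.2 (Nat.cast_le.2 ?_))
        exact EntHom.height_le_of_not_separates fun h' =>
          (h.height_lt.trans ((h'.mono (hD l hl i)).height_lt)).false
    · exact mul_pos (lt_of_le_of_ne (hu k) hk.symm) (sub_pos.2 (Nat.cast_lt.2 h.height_lt))
  · contrapose!
    intro h
    refine Finset.sum_nonpos fun l _ => ?_
    by_cases hl : u l = 0
    · simp [hl]
    · refine mul_nonpos_of_nonneg_of_nonpos (hu l) (sub_nonpos.2 (Nat.cast_le.2 ?_))
      exact EntHom.height_le_of_not_separates fun h' => h (h'.mono (hD l hl i))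

theorem Carries.eq_zero {hxy : ∀ i, y i < x i} (hb : ∀ i, b i ∈ (x i).1 ∧ b i ∉ (y i).1)
    {p : VertexIndex x y b → ℝ} (h : Carries (fun i => EntHom.pair (hxy i)) p) : p = 0 := by
  funext ⟨i, a, ha⟩
  have hp : vertexFun p i a = p ⟨i, a, ha⟩ := dif_pos ha
  have hp0 : vertexFun p i (b i) = 0 := by simp [vertexFun]
  have h1 := (h i a (b i) ha.1 ha.2.1 (hb i).1 (hb i).2).not.1
    (EntHom.not_separates_pair _ ha.1 (hb i).2)
  have h2 := (h i (b i) a (hb i).1 (hb i).2 ha.1 ha.2.1).not.1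
    (EntHom.not_separates_pair _ (hb i).1 ha.2.1)
  rw [hp, hp0] at h1 h2
  exact le_antisymm (not_lt.1 h2) (not_lt.1 h1)

/-- Subtracting as much as possible of the vector of its carrier makes the carrier of a point
smaller. -/
theorem Carries.exists_sub_smul [Finite I] {hxy : ∀ i, y i < x i} {C : ∀ i, EntHom (x i) (y i)}
    {p : VertexIndex x y b → ℝ} (hC : Carries C p) (hne : C ≠ fun i => EntHom.pair (hxy i)) :
    ∃ ε : ℝ, 0 < ε ∧ ∃ C', C' < C ∧ Carries C' (p - ε • pathVector b C) := by
  classical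
  let T : Set (I × V × V) := {t | (t.2.1 ∈ (x t.1).1 ∧ t.2.1 ∉ (y t.1).1 ∧ t.2.2 ∈ (x t.1).1 ∧
    t.2.2 ∉ (y t.1).1) ∧ (C t.1).Separates t.2.1 t.2.2}
  have hT : T.Finite := by
    refine (Set.Finite.prod (Set.finite_univ (α := I))
      (((Set.finite_iUnion fun i => (x i).1.finite_toSet)).prod
        (Set.finite_iUnion fun i => (x i).1.finite_toSet))).subset ?_
    rintro ⟨i, a, a'⟩ ⟨h, -⟩
    exact ⟨trivial, Set.mem_iUnion.2 ⟨i, h.1⟩, Set.mem_iUnion.2 ⟨i, h.2.2.1⟩⟩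
  have hTne : T.Nonempty := by
    by_contra h
    refine hne (le_antisymm (fun i => EntHom.le_of_separates fun a a' h1 h2 h3 h4 hs => ?_)
      fun i => EntHom.pair_le _ _)
    exact absurd ⟨(i, a, a'), ⟨h1, h2, h3, h4⟩, hs⟩ h
  let ρ : I × V × V → ℝ := fun t => (vertexFun p t.1 t.2.2 - vertexFun p t.1 t.2.1) /
    ((C t.1).height t.2.2 - (C t.1).height t.2.1)
  obtain ⟨t, htT, htmin⟩ := Set.exists_min_image T ρ hT hTne
  have hden : ∀ s ∈ T, (0 : ℝ) < (C s.1).height s.2.2 - (C s.1).height s.2.1 := fun s hs =>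
    sub_pos.2 (Nat.cast_lt.2 hs.2.height_lt)
  have hnum : ∀ s ∈ T, 0 < vertexFun p s.1 s.2.2 - vertexFun p s.1 s.2.1 := fun s hs =>
    sub_pos.2 ((hC _ _ _ hs.1.1 hs.1.2.1 hs.1.2.2.1 hs.1.2.2.2).1 hs.2)
  obtain ⟨C', hC'⟩ := exists_carries hxy (p - ρ t • pathVector b C)
  have hdiff : ∀ i a a', a ∈ (x i).1 → a ∉ (y i).1 → a' ∈ (x i).1 → a' ∉ (y i).1 →
      vertexFun (p - ρ t • pathVector b C) i a' - vertexFun (p - ρ t • pathVector b C) i a =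
      (vertexFun p i a' - vertexFun p i a) - ρ t * ((C i).height a' - (C i).height a) := by
    intro i a a' h1 h2 h3 h4
    rw [vertexFun_sub_smul, vertexFun_sub_smul, vertexFun_pathVector _ h1 h2,
      vertexFun_pathVector _ h3 h4]
    ring
  refine ⟨ρ t, div_pos (hnum t htT) (hden t htT), C', lt_of_le_of_ne ?_ ?_, hC'⟩
  · refine fun i => EntHom.le_of_separates fun a a' h1 h2 h3 h4 hs => ?_
    have hlt := sub_pos.2 ((hC' i a a' h1 h2 h3 h4).1 hs)
    rw [hdiff i a a' h1 h2 h3 h4] at hlt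
    by_contra hns
    have h5 := not_lt.1 ((hC i a a' h1 h2 h3 h4).not.1 hns)
    by_cases hs' : (C i).Separates a' a
    · have hm : (i, a', a) ∈ T := ⟨⟨h3, h4, h1, h2⟩, hs'⟩
      have h6 := htmin _ hm
      have h7 := (le_div_iff₀ (hden _ hm)).1 h6
      simp only at h7
      linarith
    · have h6 := not_lt.1 ((hC i a' a h3 h4 h1 h2).not.1 hs')
      have h7 : (C i).height a = (C i).height a' := le_antisymm
        (EntHom.height_le_of_not_separates hs') (EntHom.height_le_of_not_separates hns)
      rw [h7] at hlt
      linarith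
  · rintro rfl
    have hlt := sub_pos.2 ((hC' _ _ _ htT.1.1 htT.1.2.1 htT.1.2.2.1 htT.1.2.2.2).1 htT.2)
    rw [hdiff _ _ _ htT.1.1 htT.1.2.1 htT.1.2.2.1 htT.1.2.2.2,
      div_mul_cancel₀ _ (hden t htT).ne', sub_self] at hlt
    exact hlt.false

/-- The nontrivial families of entrance paths carry a chain fan: this is the barycentric subdivision
of the normal fan of a product of permutohedra. -/
theorem isChainFan_pathVector [Finite I] (hxy : ∀ i, y i < x i)
    (hb : ∀ i, b i ∈ (x i).1 ∧ b i ∉ (y i).1) {C₀ : ∀ i, EntHom (x i) (y i)}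
    (hC₀ : C₀ = fun i => EntHom.pair (hxy i)) [Fintype {C : ∀ i, EntHom (x i) (y i) // C ≠ C₀}]
    [Finite (∀ i, EntHom (x i) (y i))] :
    IsChainFan fun C : {C : ∀ i, EntHom (x i) (y i) // C ≠ C₀} => pathVector b C.1 := by
  classical
  have H : ∀ (C : ∀ i, EntHom (x i) (y i)) (p : VertexIndex x y b → ℝ), Carries C p →
      ∃ a : {C // C ≠ C₀} → ℝ, ((∀ q, 0 ≤ a q) ∧ IsChain (· ≤ ·) {q | a q ≠ 0} ∧
        ∑ q, a q • pathVector b q.1 = p) ∧ ∀ q, a q ≠ 0 → q.1 ≤ C := by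
    intro C
    induction C using (wellFounded_lt (α := ∀ i, EntHom (x i) (y i))).induction with
    | _ C ih =>
      intro p hC
      by_cases hne : C = C₀
      · subst hne
        subst hC₀
        exact ⟨0, ⟨by simp, by simp [IsChain], by simp [hC.eq_zero hb]⟩, by simp⟩
      · obtain ⟨ε, hε, C', hlt, hC'⟩ := hC.exists_sub_smul (hxy := hxy) (hC₀ ▸ hne)
        obtain ⟨a, ⟨ha0, hac, hap⟩, haC⟩ := ih C' hlt _ hC'
        let r : {C // C ≠ C₀} := ⟨C, hne⟩
        let s : {C // C ≠ C₀} → ℝ := Pi.single r ε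
        have hs : 0 ≤ s := Pi.single_nonneg.2 hε.le
        have hsupp : ∀ q, (a + s) q ≠ 0 → q = r ∨ a q ≠ 0 := by
          intro q hq
          by_cases h : q = r
          · exact .inl h
          · exact .inr (by simpa [s, Pi.single_eq_of_ne h] using hq)
        refine ⟨a + s, ⟨fun q => ?_, ?_, ?_⟩, fun q hq => ?_⟩
        · exact add_nonneg (ha0 q) (hs q)
        · intro q hq q' hq' hqq
          rcases hsupp q hq with rfl | h1 <;> rcases hsupp q' hq' with rfl | h2
          · exact absurd rfl hqq
          · exact .inr ((haC _ h2).trans hlt.le)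
          · exact .inl ((haC _ h1).trans hlt.le)
          · exact hac h1 h2 hqq
        · simp only [Pi.add_apply, add_smul, Finset.sum_add_distrib, hap]
          rw [Finset.sum_eq_single r (fun q _ hq => by simp [s, Pi.single_eq_of_ne hq])
            (by simp), show s r = ε by simp [s]]
          exact sub_add_cancel _ _
        · rcases hsupp q hq with rfl | h
          · exact le_rfl
          · exact (haC _ h).trans hlt.le
  intro p
  refine existsUnique_of_exists_of_unique ?_ ?_
  · obtain ⟨C, hC⟩ := exists_carries hxy p
    exact (H C p hC).imp fun a ha => ha.1
  · rintro a a' ⟨ha0, hac, hap⟩ ⟨ha0', hac', hap'⟩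
    -- Subtracting the common part `m` leaves combinations with disjoint supports; their carriers,
    -- the largest elements of these supports, agree only if both combinations are trivial.
    let m : {C // C ≠ C₀} → ℝ := fun q => min (a q) (a' q)
    have htop : ∀ u : {C // C ≠ C₀} → ℝ, IsChain (· ≤ ·) {q | u q ≠ 0} →
        ∃ C, (∀ q, u q ≠ 0 → q.1 ≤ C) ∧ (C = C₀ ∨ ∃ q : {C // C ≠ C₀}, q.1 = C ∧ u q ≠ 0) := by
      intro u hu
      by_cases h : ∃ q, u q ≠ 0
      · obtain ⟨q, hq⟩ := h
        obtain ⟨r, hr⟩ := Finset.exists_maximal (s := Finset.univ.filter (u · ≠ 0))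
          ⟨q, by simpa using hq⟩
        have hr1 := (Finset.mem_filter.1 hr.1).2
        refine ⟨r.1, fun q hq => ?_, .inr ⟨r, rfl, hr1⟩⟩
        rcases hu.total hq hr1 with h | h
        · exact h
        · exact hr.2 (by simpa using hq) h
      · push Not at h
        exact ⟨C₀, fun q hq => absurd (h q) hq, .inl rfl⟩
    have hm : ∀ q, m q ≤ a q ∧ m q ≤ a' q := fun q => ⟨min_le_left _ _, min_le_right _ _⟩
    have hm0 : ∀ q, 0 ≤ m q := fun q => le_min (ha0 q) (ha0' q)
    have hc1 : IsChain (· ≤ ·) {q | a q - m q ≠ 0} := hac.mono (by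
      intro q hq h
      have := hm0 q
      have := (hm q).1
      exact hq (by linarith))
    have hc2 : IsChain (· ≤ ·) {q | a' q - m q ≠ 0} := hac'.mono (by
      intro q hq h
      have := hm0 q
      have := (hm q).2
      exact hq (by linarith))
    subst hC₀
    obtain ⟨C, hC, hC2⟩ := htop _ hc1
    obtain ⟨D, hD, hD2⟩ := htop _ hc2
    have h1 := carries_sum (b := b) (hxy := hxy) (fun q => sub_nonneg.2 (hm q).1)
      (fun q => q.1) hC hC2
    have h2 := carries_sum (b := b) (hxy := hxy) (fun q => sub_nonneg.2 (hm q).2)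
      (fun q => q.1) hD hD2
    simp only [sub_smul, Finset.sum_sub_distrib] at h1 h2
    rw [hap] at h1
    rw [hap'] at h2
    obtain rfl := h1.unique h2
    rcases hC2 with rfl | ⟨q, rfl, hq⟩
    · funext q
      have hz : ∀ {r : ℝ}, (r ≠ 0 → q.1 ≤ fun i => EntHom.pair (hxy i)) → r = 0 := fun hr =>
        by_contra fun h => q.2 (le_antisymm (hr h) fun i => EntHom.pair_le _ _)
      have h3 := hz (hC q)
      have h4 := hz (hD q)
      linarith
    · obtain ⟨q', hqq, hq'⟩ := hD2.resolve_left q.2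
      obtain rfl : q' = q := Subtype.ext hqq
      exfalso
      rcases min_choice (a q') (a' q') with h | h
      · exact hq (sub_eq_zero.2 h.symm)
      · exact hq' (sub_eq_zero.2 h.symm)

/-- The number of coordinates is the dimension of the product of permutohedra. -/
theorem natCard_vertexIndex [Fintype I] (hxy : ∀ i, y i < x i) (hb : ∀ i, b i ∈ (x i).1 ∧ b i ∉ (y i).1) :
    (Nat.card (VertexIndex x y b) : ℤ) = ∑ i, ((x i).1.card - (y i).1.card - 1 : ℤ) := by
  classical
  have : ∀ i, Finite {a : V // a ∈ (x i).1 ∧ a ∉ (y i).1 ∧ a ≠ b i} := fun i =>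
    ((x i).1.finite_toSet.subset fun a ha => ha.1).to_subtype
  rw [Nat.card_sigma, Nat.cast_sum]
  refine Finset.sum_congr rfl fun i _ => ?_
  have h1 : Nat.card {a : V // a ∈ (x i).1 ∧ a ∉ (y i).1 ∧ a ≠ b i} =
      (((x i).1 \ (y i).1).erase (b i)).card := by
    refine Nat.subtype_card _ fun a => ?_
    simp only [Finset.mem_erase, Finset.mem_sdiff]
    tauto
  rw [h1, Finset.card_erase_of_mem (Finset.mem_sdiff.2 (hb i)),
    Finset.card_sdiff_of_subset (hxy i).le]
  have h2 := Finset.card_lt_card (show (y i).1 ⊂ (x i).1 from hxy i)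
  omega

end PathFamilies

/-! ### The fans of the lower intervals -/

namespace AcyclicMatching

variable {V : Type u} {X : PreAbstractSimplicialComplex V} {M : AcyclicMatching (Cell X)}
  {x z : Cell X}

/-- The dimension of the cell of a morphism: that of the product of permutohedra whose faces are the
morphisms above it. -/
noncomputable def dim (γ : M.obj x ⟶ M.obj z) : ℕ :=
  (wordDim (fun c : Cell X => (c.1.card : ℤ)) (Eval.exists_isReduced γ).choose).toNat

theorem Eval.natCast_dim (hc : ∀ x u, M.pair x u → x.1.card = u.1.card + 1)
    {L : List ((Cell X × Cell X) × Bool)} {γ : M.obj x ⟶ M.obj z} (H : Eval x z L γ) :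
    (dim γ : ℤ) = wordDim (fun c : Cell X => (c.1.card : ℤ)) L := by
  have H' := (Eval.exists_isReduced γ).choose_spec.1
  rw [dim, Int.toNat_of_nonneg]
  · exact H'.wordDim_eq (fun x u h => by simp [hc x u h]) H
  · refine List.sum_nonneg fun a ha => ?_
    obtain ⟨l, hl, rfl⟩ := List.mem_map.1 ha
    have := Finset.card_lt_card (show l.1.2.1 ⊂ l.1.1.1 from H'.lt l hl)
    simp only
    omega

theorem dim_lt (hc : ∀ x u, M.pair x u → x.1.card = u.1.card + 1) {γ γ' : M.obj x ⟶ M.obj z}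
    (h : γ < γ') : dim γ' < dim γ := by
  obtain ⟨L, L', H, H', hr⟩ := h.le
  rcases H.eq_or_wordDim_lt (fun c : Cell X => (c.1.card : ℤ)) hr with rfl | hlt
  · exact absurd (Eval.unique H H') h.ne
  · rw [← H.natCast_dim hc, ← H'.natCast_dim hc] at hlt
    exact_mod_cast hlt

theorem finite_pathFamily (L : List ((Cell X × Cell X) × Bool)) : Finite (PathFamily L) := by
  have : ∀ i : Fin L.length, Finite (EntHom (L.get i).1.1 (L.get i).1.2) := fun i => by
    refine EntHom.finite (Set.Finite.of_finite_image (f := Subtype.val)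
      ((Finset.finite_toSet (L.get i).1.1.1.powerset).subset ?_) Subtype.val_injective.injOn)
    rintro _ ⟨c, hc, rfl⟩
    exact Finset.mem_coe.2 (Finset.mem_powerset.2 hc.2)
  exact Pi.finite

theorem finite_Ici (γ : M.obj x ⟶ M.obj z) : (Set.Ici γ).Finite := by
  obtain ⟨L, H, hL⟩ := Eval.exists_isReduced γ
  obtain ⟨e, -⟩ := H.exists_parametrization hL
  have := finite_pathFamily L
  exact @Set.toFinite _ _ (Finite.of_equiv _ e)

/-- The morphisms strictly above a given one carry a chain fan. -/
theorem exists_isChainFan (hc : ∀ x u, M.pair x u → x.1.card = u.1.card + 1)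
    (γ : (M.obj x ⟶ M.obj z)ᵒᵈ) [Fintype {γ' // γ' < γ}] :
    ∃ v : {γ' // γ' < γ} → (Fin (dim (OrderDual.ofDual γ)) → ℝ), IsChainFan v := by
  classical
  obtain ⟨L, H, hL⟩ := Eval.exists_isReduced (OrderDual.ofDual γ)
  obtain ⟨e, he, heL⟩ := H.exists_parametrization hL
  have hxy : ∀ i, (L.get i).1.2 < (L.get i).1.1 := fun i => H.lt _ (L.get_mem i)
  choose b hb using fun i => Finset.exists_of_ssubset
    (show (L.get i).1.2.1 ⊂ (L.get i).1.1.1 from hxy i)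
  have := finite_pathFamily L
  let C₀ : PathFamily L := fun i => EntHom.pair (hxy i)
  have he₀ : (e C₀).1 = OrderDual.ofDual γ := by
    have h := heL C₀
    rw [refineWord_pair] at h
    exact h.unique H
  let E : {γ' // γ' < γ} ≃ {C : PathFamily L // C ≠ C₀} :=
    { toFun := fun γ' => ⟨e.symm ⟨OrderDual.ofDual γ'.1, γ'.2.le⟩, fun h => γ'.2.ne <| by
        rw [Equiv.symm_apply_eq] at h
        exact (congrArg Subtype.val h).trans he₀⟩
      invFun := fun C => ⟨OrderDual.toDual (e C.1).1, lt_of_le_of_ne (e C.1).2 fun h =>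
        C.2 (e.injective (Subtype.ext (h.trans he₀.symm)))⟩
      left_inv := fun γ' => Subtype.ext (by simp)
      right_inv := fun C => Subtype.ext (by simp) }
  have hE : ∀ a b, E a ≤ E b ↔ b ≤ a := fun a b => by
    change e.symm _ ≤ e.symm _ ↔ _
    rw [← he, e.apply_symm_apply, e.apply_symm_apply]
    rfl
  have : Fintype {C : PathFamily L // C ≠ C₀} := Fintype.ofFinite _
  have hfan := isChainFan_pathVector (I := Fin L.length) hxy hb (C₀ := C₀) rfl
  have hcard : Nat.card (VertexIndex (fun i => (L.get i).1.1) (fun i => (L.get i).1.2) b) =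
      dim (OrderDual.ofDual γ) := by
    have h := natCard_vertexIndex hxy hb
    rw [← Nat.cast_inj (R := ℤ), h, H.natCast_dim hc, wordDim,
      ← Fin.sum_univ_fun_getElem]
    rfl
  refine ⟨_, (hfan.linearEquiv (LinearEquiv.funCongrLeft ℝ ℝ
    (Finite.equivFinOfCardEq hcard).symm)).comp_equiv E fun a b => ?_⟩
  rw [hE, hE, or_comm]

end AcyclicMatching

/-! ### The matching of a discrete Morse function -/

namespace DiscreteMorseFunction

variable {V : Type u} {X : PreAbstractSimplicialComplex V}

theorem IsFacet.lt {u x : Cell X} (h : IsFacet u x) : u < x :=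
  lt_of_le_of_ne h.1 fun he => by have := h.2; rw [he] at this; omega

/-- A simplex is not both the larger cell of a regular pair and the smaller cell of another one. -/
theorem not_isRegularPair_of_isRegularPair (f : DiscreteMorseFunction X) {v u x : Cell X}
    (h : f.IsRegularPair u x) : ¬ f.IsRegularPair v u := by
  classical
  intro h'
  -- The facet `u'` of `x` containing `v` other than `u` would satisfy
  -- `f u' < f x ≤ f u ≤ f v < f u'`.
  obtain ⟨b, hbx, hbu⟩ := Finset.exists_of_ssubset (show u.1 ⊂ x.1 from IsFacet.lt h.1)
  have hbv : b ∉ v.1 := fun hb => hbu (h'.1.1 hb)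
  have hsub : insert b v.1 ⊆ x.1 := Finset.insert_subset hbx (h'.1.1.trans h.1.1)
  let u' : Cell X := ⟨insert b v.1,
    (X.isRelLowerSet_faces x.2).2 hsub (Finset.insert_nonempty _ _)⟩
  have hne : u' ≠ u := fun he => hbu (he ▸ Finset.mem_insert_self b v.1)
  have hcard : u'.1.card = v.1.card + 1 := Finset.card_insert_of_notMem hbv
  have h1 : IsFacet u' x := ⟨hsub, by rw [hcard, h.1.2, h'.1.2]⟩
  have h2 : IsFacet v u' := ⟨Finset.subset_insert _ _, hcard⟩
  have h3 : f.toFun u' < f.toFun x := not_le.1 fun hle => hne (f.face x u' u h1 hle h.1 h.2)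
  have h4 : f.toFun v < f.toFun u' := not_le.1 fun hle => hne (f.coface v u' u h2 hle h'.1 h'.2)
  have h5 := h.2
  have h6 := h'.2
  linarith

/-- The regular pairs of a discrete Morse function form an acyclic matching, ranked by dimension and
value. -/
def matching (f : DiscreteMorseFunction X) : AcyclicMatching (Cell X) where
  pair x u := f.IsRegularPair u x
  rank x := toLex (x.1.card, f.toFun x)
  covBy {x u} h := by
    refine ⟨IsFacet.lt h.1, fun c h1 h2 => ?_⟩
    have h3 := Finset.card_lt_card (show u.1 ⊂ c.1 from h1)
    have h4 := Finset.card_lt_card (show c.1 ⊂ x.1 from h2)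
    have := h.1.2
    omega
  upper_unique h h' := f.coface _ _ _ h.1 h.2 h'.1 h'.2
  not_pair h := f.not_isRegularPair_of_isRegularPair h
  rank_strictMono c d h :=
    Prod.Lex.toLex_lt_toLex.2 (.inl (Finset.card_lt_card (show c.1 ⊂ d.1 from h)))
  rank_lt {x x' u} h1 h2 h3 := by
    have h4 := Finset.card_lt_card (show u.1 ⊂ x.1 from h1)
    refine Prod.Lex.toLex_lt_toLex.2 ?_
    by_cases h5 : x.1.card = u.1.card + 1
    · have h6 : f.toFun u < f.toFun x := not_le.1 fun h => h2 ⟨⟨h1.le, h5⟩, h⟩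
      exact .inr ⟨h3.1.2.trans h5.symm, lt_of_le_of_lt h3.2 h6⟩
    · left
      have := h3.1.2
      simp only
      omega

end DiscreteMorseFunction

theorem theoremA {V : Type u} (X : PreAbstractSimplicialComplex V) (hX : X.faces.Finite)
    (f : DiscreteMorseFunction X) (w z : DiscreteMorseFunction.Flo f) :
    ∃ ord : PartialOrder (w ⟶ z),
      (∀ γ γ' : w ⟶ z, ord.le γ γ' ↔ DiscreteMorseFunction.Flo.Implies γ γ') ∧
      (Nonempty (w ⟶ z) → IsCWPoset (WithBot (w ⟶ z)ᵒᵈ)) ∧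
      IsRegularCWFacePoset (w ⟶ z)ᵒᵈ := by
  have hc : ∀ x u, f.matching.pair x u → x.1.card = u.1.card + 1 := fun x u h => h.1.2
  refine ⟨AcyclicMatching.homOrder (M := f.matching) w.cell z.cell,
    fun γ γ' => AcyclicMatching.below_iff_implies (M := f.matching), fun hne => ?_, ?_⟩
  · have : Nonempty (f.matching.obj w.cell ⟶ f.matching.obj z.cell)ᵒᵈ := hne
    exact isCWPoset_withBot_of_isChainFan (P := (f.matching.obj w.cell ⟶ f.matching.obj z.cell)ᵒᵈ)
      (fun γ => AcyclicMatching.dim (OrderDual.ofDual γ))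
      (fun γ => AcyclicMatching.finite_Ici (OrderDual.ofDual γ))
      fun γ => AcyclicMatching.exists_isChainFan hc γ
  · exact isRegularCWFacePoset_of_isChainFan
      (P := (f.matching.obj w.cell ⟶ f.matching.obj z.cell)ᵒᵈ)
      (fun γ => AcyclicMatching.dim (OrderDual.ofDual γ)) (fun γ γ' h => AcyclicMatching.dim_lt hc h)
      (fun γ => AcyclicMatching.finite_Ici (OrderDual.ofDual γ))
      fun γ => AcyclicMatching.exists_isChainFan hc γ
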